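/- Graphs are finite and simple. A graph contains no $C_k$ if it has no subgraph, induced or not, that is a cycle on $k$ vertices. A complete bipartite induced subgraph $B$ of $G$, with (nonempty) sides $B_X$ and $B_Y$, is called generating if there is an independent set $S$ of $G$ such that $S\cup B_X$ and $S\cup B_Y$ are both maximal (with respect to inclusion) independent sets of $G$. Theorem. The following problem can be solved in polynomial time, namely in $O(|V|(|V|+|E|))$ steps on a random-access machine that receives $G$ by adjacency lists and $B$ by its vertex set. Input: a graph $G=(V,E)$ that contains no $C_4$, no $C_6$ and no $C_7$, and a complete bipartite induced subgraph $B$ of $G$. Question: is $B$ a generating subgraph of $G$? -/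

import Mathlib

/-! ### Generating subgraphs -/

/-- `X` and `Y` are the two sides of a complete bipartite induced subgraph of `G` with vertex
set `B`: they partition `B`, both are nonempty and independent in `G`, and every vertex of `X`
is adjacent to every vertex of `Y`. -/
structure IsCompleteBipartition {V : Type*} (G : SimpleGraph V) (B X Y : Set V) : Prop where
  nonempty_left : X.Nonempty
  nonempty_right : Y.Nonempty
  disjoint : Disjoint X Y
  union_eq : X ∪ Y = B
  indep_left : G.IsIndepSet X
  indep_right : G.IsIndepSet Y
  adj : ∀ x ∈ X, ∀ y ∈ Y, G.Adj x y

/-- The subgraph of `G` induced by `B` is complete bipartite. -/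
def InducesCompleteBipartite {V : Type*} (G : SimpleGraph V) (B : Set V) : Prop :=
  ∃ X Y : Set V, IsCompleteBipartition G B X Y

/-- `S` is an (inclusion-)maximal independent set of `G`. -/
def IsMaximalIndep {V : Type*} (G : SimpleGraph V) (S : Set V) : Prop :=
  Maximal (fun T : Set V => G.IsIndepSet T) S

/-- The complete bipartite induced subgraph of `G` with vertex set `B` is generating: with `X`
and `Y` its two sides (they are determined by `B` up to their order), there is an independent set
`S` such that `S ∪ X` and `S ∪ Y` are both maximal independent sets of `G`. -/
def IsGenerating {V : Type*} (G : SimpleGraph V) (B : Set V) : Prop :=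
  ∃ X Y : Set V, IsCompleteBipartition G B X Y ∧
    ∃ S : Set V, G.IsIndepSet S ∧ IsMaximalIndep G (S ∪ X) ∧ IsMaximalIndep G (S ∪ Y)

/-! ### A random-access machine with a step count

Programs are finite, so each of them names only finitely many registers and arrays.  The only
arithmetic is successor and predecessor.  Hence after `t` steps every stored number is at most
`t` plus the largest number in the input and in the program; in polynomial time all numbers have
`O(log n)` bits, and counting every instruction as one step is the usual time measure. -/

namespace RAM

/-- The memory: registers, and arrays of unbounded length, all with natural number entries. -/
@[ext]
structure State where
  reg : ℕ → ℕ
  arr : ℕ → ℕ → ℕ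

/-- Write `x` into register `r`. -/
def State.setReg (s : State) (r x : ℕ) : State :=
  { s with reg := Function.update s.reg r x }

/-- Write `x` into entry `i` of array `a`. -/
def State.setArr (s : State) (a i x : ℕ) : State :=
  { s with arr := Function.update s.arr a (Function.update (s.arr a) i x) }

/-- Comparisons of two registers. -/
inductive Test where
  | lt (q r : ℕ)
  | eq (q r : ℕ)

/-- The outcome of a comparison. -/
def Test.holds (s : State) : Test → Prop
  | .lt q r => s.reg q < s.reg r
  | .eq q r => s.reg q = s.reg r

/-- Programs; numerals `q`, `r` name registers, `a` names an array, `k` is a constant.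
* `const r k` is `r := k`, `copy r q` is `r := q`, `succ r` is `r := r + 1`,
  `pred r` is `r := r - 1` (with `0 - 1 = 0`);
* `load r a q` is `r := a[q]` and `store a q r` is `a[q] := r`: the contents of register `q`
  are used as the index;
* `skip`, `seq`, `branch`, `loop` are the empty instruction, composition, if-then-else, while. -/
inductive Prog where
  | skip
  | const (r k : ℕ)
  | copy (r q : ℕ)
  | succ (r : ℕ)
  | pred (r : ℕ)
  | load (r a q : ℕ)
  | store (a q r : ℕ)
  | seq (p p' : Prog)
  | branch (b : Test) (p p' : Prog)
  | loop (b : Test) (p : Prog)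

/-- `Exec p s t s'`: started in state `s`, the program `p` halts in state `s'` after exactly `t`
steps, where every elementary instruction and every evaluation of a test is one step. -/
inductive Exec : Prog → State → ℕ → State → Prop
  | skip (s : State) : Exec .skip s 1 s
  | const (s : State) (r k : ℕ) : Exec (.const r k) s 1 (s.setReg r k)
  | copy (s : State) (r q : ℕ) : Exec (.copy r q) s 1 (s.setReg r (s.reg q))
  | succ (s : State) (r : ℕ) : Exec (.succ r) s 1 (s.setReg r (s.reg r + 1))
  | pred (s : State) (r : ℕ) : Exec (.pred r) s 1 (s.setReg r (s.reg r - 1))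
  | load (s : State) (r a q : ℕ) : Exec (.load r a q) s 1 (s.setReg r (s.arr a (s.reg q)))
  | store (s : State) (a q r : ℕ) : Exec (.store a q r) s 1 (s.setArr a (s.reg q) (s.reg r))
  | seq {p p' : Prog} {s s' s'' : State} {t t' : ℕ} :
      Exec p s t s' → Exec p' s' t' s'' → Exec (.seq p p') s (t + t') s''
  | branch_true {b : Test} {p p' : Prog} {s s' : State} {t : ℕ} :
      b.holds s → Exec p s t s' → Exec (.branch b p p') s (1 + t) s'
  | branch_false {b : Test} {p p' : Prog} {s s' : State} {t : ℕ} :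
      ¬ b.holds s → Exec p' s t s' → Exec (.branch b p p') s (1 + t) s'
  | loop_true {b : Test} {p : Prog} {s s' s'' : State} {t t' : ℕ} :
      b.holds s → Exec p s t s' → Exec (.loop b p) s' t' s'' →
      Exec (.loop b p) s (1 + t + t') s''
  | loop_false {b : Test} {p : Prog} {s : State} :
      ¬ b.holds s → Exec (.loop b p) s 1 s

/-- The machine is deterministic: a program has at most one halting run from a given state. -/
theorem Exec.deterministic {p : Prog} {s s₁ s₂ : State} {t₁ t₂ : ℕ}
    (h₁ : Exec p s t₁ s₁) (h₂ : Exec p s t₂ s₂) : t₁ = t₂ ∧ s₁ = s₂ := by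
  induction h₁ generalizing t₂ s₂ with
  | skip | const | copy | succ | pred | load | store => cases h₂; exact ⟨rfl, rfl⟩
  | seq _ _ ih ih' =>
    cases h₂ with
    | seq k k' =>
      obtain ⟨rfl, rfl⟩ := ih k
      obtain ⟨rfl, rfl⟩ := ih' k'
      exact ⟨rfl, rfl⟩
  | branch_true hb _ ih =>
    cases h₂ with
    | branch_true _ k => obtain ⟨rfl, rfl⟩ := ih k; exact ⟨rfl, rfl⟩
    | branch_false hb' _ => exact absurd hb hb'
  | branch_false hb _ ih =>
    cases h₂ with
    | branch_true hb' _ => exact absurd hb' hb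
    | branch_false _ k => obtain ⟨rfl, rfl⟩ := ih k; exact ⟨rfl, rfl⟩
  | loop_true hb _ _ ih ih' =>
    cases h₂ with
    | loop_true _ k k' =>
      obtain ⟨rfl, rfl⟩ := ih k
      obtain ⟨rfl, rfl⟩ := ih' k'
      exact ⟨rfl, rfl⟩
    | loop_false hb' => exact absurd hb hb'
  | loop_false hb =>
    cases h₂ with
    | loop_true hb' _ _ => exact absurd hb' hb
    | loop_false _ => exact ⟨rfl, rfl⟩

end RAM

/-! ### The input -/

/-- `nbr` is an adjacency-list representation of `G`: the list `nbr v` enumerates the neighbours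
of `v`, in any order and without repetition. -/
def IsAdjLists {n : ℕ} (G : SimpleGraph (Fin n)) (nbr : Fin n → List (Fin n)) : Prop :=
  ∀ v, (nbr v).Nodup ∧ ∀ w, w ∈ nbr v ↔ G.Adj v w

/-- The initial memory for the adjacency lists `nbr` of a graph on `{0, …, n - 1}` and a set `B`
of its vertices.  Register `0` holds `n`.  Array `1` holds the adjacency lists of
`0, …, n - 1`, one after the other; for `i ≤ n`, entry `i` of array `0` is the total length of the
lists of the vertices below `i`, so that the list of `v` occupies the positions from `arr 0 v` up
to, but not including, `arr 0 (v + 1)`.  Array `2` is the characteristic vector of `B`.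
Everything else is `0`. -/
def inputState {n : ℕ} (nbr : Fin n → List (Fin n)) (B : Finset (Fin n)) : RAM.State where
  reg r := if r = 0 then n else 0
  arr a i :=
    if a = 0 then (if i ≤ n then (((List.ofFn nbr).take i).flatten).length else 0)
    else if a = 1 then ((List.ofFn nbr).flatten.map Fin.val).getD i 0
    else if a = 2 then (if i ∈ B.map Fin.valEmbedding then 1 else 0)
    else 0

/-! ### Short cycles -/

namespace SimpleGraph

variable {V : Type*} {G : SimpleGraph V}

/-! Call a vertex outside `X ∪ Y` far if it has no neighbour in `X ∪ Y`, and one-sided if it has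
neighbours in exactly one of the two sides. The subgraph is generating iff some independent set of
far vertices dominates all one-sided vertices (`isGenerating_iff`): such a set extends to a maximal
independent set of far vertices, and every other vertex is dominated by either side.

Without `C_4` one side is a single vertex `x`. The forbidden cycles then give three facts about far
vertices. Each has at most one one-sided neighbour per side (`eq_of_adj_farSet`). The one-sided
neighbours of two adjacent far vertices lie on the same side (`exists_common_root`). Among the far
vertices that have a one-sided neighbour, each has at most one neighbour (`eq_of_adj_of_adj`).

So domination is a satisfiability problem: one-sided vertices are clauses, and a far vertex, or a
pair of adjacent far vertices excluding each other, is a variable that occurs in at most two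
clauses. If every clause contains at least two variables, Hall's theorem assigns different variables
to different clauses, and all clauses are satisfied at once. Clauses with a single literal are
removed by unit propagation: the only available neighbour of a one-sided vertex is forced, and its
neighbours become unavailable. Forced vertices belong to every solution (`selection_invariant`).
Conversely, once propagation is stable and every clause still has a literal, single literals are
isolated among the available vertices and do not interfere with Hall's choice
(`exists_indep_dominating`).

Each unstable round discards a vertex, so `n` rounds suffice. A round is two scans of the adjacency
lists, of `O(|V| + |E|)` steps each. The machine part is an invariant rule for such scans
(`exec_scan`), applied to each phase of the program. -/

theorem not_free_cycleGraph_of_injective {k : ℕ} (f : Fin (k + 1) → V)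
    (hf : Function.Injective f) (h : ∀ i, G.Adj (f i) (f (i + 1))) :
    ¬ (cycleGraph (k + 1)).Free G := by
  intro hfree
  refine hfree ⟨⟨⟨f, ?_⟩, hf⟩⟩
  intro i j hij
  rcases k with _ | k
  · simp [cycleGraph] at hij
  · rw [cycleGraph_adj] at hij
    rcases hij with hij | hij
    · have : i = j + 1 := by rw [← hij]; abel
      exact this ▸ (h j).symm
    · have : j = i + 1 := by rw [← hij]; abel
      exact this ▸ h i

theorem Free.not_four_cycle (hG : (cycleGraph 4).Free G) {a b c d : V}
    (hn : [a, b, c, d].Nodup) (h₁ : G.Adj a b) (h₂ : G.Adj b c) (h₃ : G.Adj c d)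
    (h₄ : G.Adj d a) : False := by
  refine not_free_cycleGraph_of_injective (k := 3) ![a, b, c, d] ?_ ?_ hG
  · rw [← List.nodup_ofFn]; simpa using hn
  · intro i; fin_cases i <;> assumption

theorem Free.not_six_cycle (hG : (cycleGraph 6).Free G) {a b c d e f : V}
    (hn : [a, b, c, d, e, f].Nodup) (h₁ : G.Adj a b) (h₂ : G.Adj b c) (h₃ : G.Adj c d)
    (h₄ : G.Adj d e) (h₅ : G.Adj e f) (h₆ : G.Adj f a) : False := by
  refine not_free_cycleGraph_of_injective (k := 5) ![a, b, c, d, e, f] ?_ ?_ hG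
  · rw [← List.nodup_ofFn]; simpa using hn
  · intro i; fin_cases i <;> assumption

theorem Free.not_seven_cycle (hG : (cycleGraph 7).Free G) {a b c d e f g : V}
    (hn : [a, b, c, d, e, f, g].Nodup) (h₁ : G.Adj a b) (h₂ : G.Adj b c) (h₃ : G.Adj c d)
    (h₄ : G.Adj d e) (h₅ : G.Adj e f) (h₆ : G.Adj f g) (h₇ : G.Adj g a) : False := by
  refine not_free_cycleGraph_of_injective (k := 6) ![a, b, c, d, e, f, g] ?_ ?_ hG
  · rw [← List.nodup_ofFn]; simpa using hn
  · intro i; fin_cases i <;> assumption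

end SimpleGraph

/-! ### Generating subgraphs and domination -/

section Domination

variable {V : Type*} {G : SimpleGraph V} {B X Y : Set V}

/-- `v` has a neighbour in `T`. -/
def HasNeighborIn (G : SimpleGraph V) (T : Set V) (v : V) : Prop :=
  ∃ t ∈ T, G.Adj t v

/-- The vertices at distance at least two from `X ∪ Y`. -/
def farSet (G : SimpleGraph V) (X Y : Set V) : Set V :=
  {v | v ∉ X ∪ Y ∧ ¬ HasNeighborIn G X v ∧ ¬ HasNeighborIn G Y v}

/-- The vertices outside `X ∪ Y` that are adjacent to exactly one of the sides `X` and `Y`. -/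
def oneSidedSet (G : SimpleGraph V) (X Y : Set V) : Set V :=
  {v | v ∉ X ∪ Y ∧ ¬ (HasNeighborIn G X v ↔ HasNeighborIn G Y v)}

theorem farSet_comm (G : SimpleGraph V) (X Y : Set V) : farSet G X Y = farSet G Y X := by
  ext v; simp only [farSet, Set.mem_ofPred_eq, Set.union_comm X Y]; tauto

theorem oneSidedSet_comm (G : SimpleGraph V) (X Y : Set V) :
    oneSidedSet G X Y = oneSidedSet G Y X := by
  ext v; simp only [oneSidedSet, Set.mem_ofPred_eq, Set.union_comm X Y]; tauto

theorem IsCompleteBipartition.symm (h : IsCompleteBipartition G B X Y) :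
    IsCompleteBipartition G B Y X where
  nonempty_left := h.nonempty_right
  nonempty_right := h.nonempty_left
  disjoint := h.disjoint.symm
  union_eq := by rw [Set.union_comm, h.union_eq]
  indep_left := h.indep_right
  indep_right := h.indep_left
  adj y hy x hx := (h.adj x hx y hy).symm

theorem SimpleGraph.IsIndepSet.not_adj {S : Set V} (h : G.IsIndepSet S) {a b : V} (ha : a ∈ S)
    (hb : b ∈ S) : ¬ G.Adj a b := fun hab => h ha hb hab.ne hab

theorem IsMaximalIndep.exists_adj {S : Set V} (h : IsMaximalIndep G S) {v : V} (hv : v ∉ S) :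
    ∃ u ∈ S, G.Adj u v := by
  by_contra! hne
  refine hv (h.2 (y := insert v S) ?_ (Set.subset_insert v S) (Set.mem_insert v S))
  intro a ha b hb hab hadj
  rcases ha with rfl | ha <;> rcases hb with rfl | hb
  · exact hab rfl
  · exact hne b hb hadj.symm
  · exact hne a ha hadj
  · exact h.1 ha hb hab hadj

theorem isMaximalIndep_of_forall_exists_adj {S : Set V} (h : G.IsIndepSet S)
    (hS : ∀ v ∉ S, ∃ u ∈ S, G.Adj u v) : IsMaximalIndep G S := by
  refine ⟨h, fun T hT hST v hv => ?_⟩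
  by_contra hvS
  obtain ⟨u, hu, huv⟩ := hS v hvS
  exact hT.not_adj (hST hu) hv huv

/-- The independent set `S` of far vertices dominates every one-sided vertex. -/
def IsDominatingFar (G : SimpleGraph V) (X Y S : Set V) : Prop :=
  S ⊆ farSet G X Y ∧ G.IsIndepSet S ∧ ∀ m ∈ oneSidedSet G X Y, ∃ w ∈ S, G.Adj m w

/-- Both sides are nonempty, so independence of both unions keeps `S` away from `X ∪ Y` and its
neighbours. A vertex that sees only one side must be dominated in the union with the other side, and
only `S` can do that. -/
theorem isDominatingFar_of_isMaximalIndep (h : IsCompleteBipartition G B X Y) {S : Set V}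
    (hX : IsMaximalIndep G (S ∪ X)) (hY : IsMaximalIndep G (S ∪ Y)) :
    IsDominatingFar G X Y S := by
  have hiX : G.IsIndepSet (S ∪ X) := hX.1
  have hiY : G.IsIndepSet (S ∪ Y) := hY.1
  refine ⟨?_, fun a ha b hb => hiX (Or.inl ha) (Or.inl hb), ?_⟩
  · intro v hv
    refine ⟨?_, ?_, ?_⟩
    · rintro (hvX | hvY)
      · obtain ⟨y, hy⟩ := h.nonempty_right
        exact hiY.not_adj (Or.inl hv) (Or.inr hy) (h.adj v hvX y hy)
      · obtain ⟨x, hx⟩ := h.nonempty_left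
        exact hiX.not_adj (Or.inr hx) (Or.inl hv) (h.adj x hx v hvY)
    · rintro ⟨x, hx, hxv⟩
      exact hiX.not_adj (Or.inr hx) (Or.inl hv) hxv
    · rintro ⟨y, hy, hyv⟩
      exact hiY.not_adj (Or.inr hy) (Or.inl hv) hyv
  · rintro m ⟨hm, hne⟩
    have key : ∀ {P Q : Set V}, G.IsIndepSet (S ∪ P) → IsMaximalIndep G (S ∪ Q) → m ∉ Q →
        HasNeighborIn G P m → ¬ HasNeighborIn G Q m → ∃ w ∈ S, G.Adj m w := by
      rintro P Q hP hQ hmQ ⟨p, hp, hpm⟩ hnQ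
      have hmS : m ∉ S := fun hmS => hP.not_adj (Or.inr hp) (Or.inl hmS) hpm
      obtain ⟨u, hu | hu, hum⟩ := hQ.exists_adj (v := m) (by simp [hmS, hmQ])
      · exact ⟨u, hu, hum.symm⟩
      · exact absurd ⟨u, hu, hum⟩ hnQ
    simp only [Set.mem_union, not_or] at hm
    by_cases hmX : HasNeighborIn G X m
    · exact key hiX hY hm.2 hmX (by tauto)
    · exact key hiY hX hm.1 (by tauto) hmX

/-- A vertex outside `T ∪ X` is dominated by `X` if it lies in `Y` or sees `X`, by `S` if it sees
only `Y`, and by maximality of `T` if it is far. -/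
theorem isMaximalIndep_union_of_maximal (h : IsCompleteBipartition G B X Y) {S T : Set V}
    (hS : IsDominatingFar G X Y S) (hST : S ⊆ T)
    (hT : Maximal (fun U : Set V => U ⊆ farSet G X Y ∧ G.IsIndepSet U) T) :
    IsMaximalIndep G (T ∪ X) := by
  obtain ⟨⟨hTW, hTi⟩, hmax⟩ := hT
  refine isMaximalIndep_of_forall_exists_adj ?_ ?_
  · intro a ha b hb hab hadj
    rcases ha with ha | ha <;> rcases hb with hb | hb
    · exact hTi ha hb hab hadj
    · exact (hTW ha).2.1 ⟨b, hb, hadj.symm⟩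
    · exact (hTW hb).2.1 ⟨a, ha, hadj⟩
    · exact h.indep_left ha hb hab hadj
  · intro v hv
    simp only [Set.mem_union, not_or] at hv
    by_contra! hne
    have hnX : ¬ HasNeighborIn G X v := fun ⟨x, hx, hxv⟩ => hne x (Or.inr hx) hxv
    by_cases hvY : v ∈ Y
    · obtain ⟨x, hx⟩ := h.nonempty_left
      exact hnX ⟨x, hx, h.adj x hx v hvY⟩
    by_cases hnY : HasNeighborIn G Y v
    · obtain ⟨w, hw, hvw⟩ := hS.2.2 v ⟨by simp [hv.2, hvY], by tauto⟩
      exact hne w (Or.inl (hST hw)) hvw.symm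
    · refine hv.1 (hmax (y := insert v T) ⟨?_, ?_⟩ (Set.subset_insert v T) (Set.mem_insert v T))
      · exact Set.insert_subset ⟨by simp [hv.2, hvY], hnX, hnY⟩ hTW
      · intro a ha b hb hab hadj
        rcases ha with rfl | ha <;> rcases hb with rfl | hb
        · exact hab rfl
        · exact hne b (Or.inl hb) hadj.symm
        · exact hne a (Or.inl ha) hadj
        · exact hTi ha hb hab hadj

/-- The side of a vertex `p` consists of the vertices of `B` not adjacent to `p`, so one vertex
determines both sides. -/
theorem IsCompleteBipartition.eq_or_eq (h : IsCompleteBipartition G B X Y) {X' Y' : Set V}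
    (h' : IsCompleteBipartition G B X' Y') : (X' = X ∧ Y' = Y) ∨ (X' = Y ∧ Y' = X) := by
  have key : ∀ {P Q P' Q' : Set V}, IsCompleteBipartition G B P Q →
      IsCompleteBipartition G B P' Q' → ∀ p ∈ P, p ∈ P' → P' ⊆ P ∧ Q' ⊆ Q := by
    intro P Q P' Q' hPQ hPQ' p hp hp'
    constructor
    · intro v hv
      have hvB : v ∈ P ∪ Q := by rw [hPQ.union_eq, ← hPQ'.union_eq]; exact Or.inl hv
      rcases hvB with hvP | hvQ
      · exact hvP
      · exact absurd (hPQ.adj p hp v hvQ) (hPQ'.indep_left.not_adj hp' hv)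
    · intro v hv
      have hvB : v ∈ P ∪ Q := by rw [hPQ.union_eq, ← hPQ'.union_eq]; exact Or.inr hv
      rcases hvB with hvP | hvQ
      · exact absurd (hPQ'.adj p hp' v hv) (hPQ.indep_left.not_adj hp hvP)
      · exact hvQ
  obtain ⟨p, hp⟩ := h.nonempty_left
  have hpB : p ∈ X' ∪ Y' := by rw [h'.union_eq, ← h.union_eq]; exact Or.inl hp
  rcases hpB with hpX | hpY
  · exact Or.inl ⟨(key h h' p hp hpX).1.antisymm (key h' h p hpX hp).1,
      (key h h' p hp hpX).2.antisymm (key h' h p hpX hp).2⟩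
  · exact Or.inr ⟨(key h h'.symm p hp hpY).2.antisymm (key h'.symm h p hpY hp).2,
      (key h h'.symm p hp hpY).1.antisymm (key h'.symm h p hpY hp).1⟩

theorem isGenerating_iff [Finite V] (h : IsCompleteBipartition G B X Y) :
    IsGenerating G B ↔ ∃ S, IsDominatingFar G X Y S := by
  constructor
  · rintro ⟨X', Y', h', S, -, hX, hY⟩
    rcases h.eq_or_eq h' with ⟨rfl, rfl⟩ | ⟨rfl, rfl⟩
    · exact ⟨S, isDominatingFar_of_isMaximalIndep h hX hY⟩
    · exact ⟨S, isDominatingFar_of_isMaximalIndep h hY hX⟩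
  · rintro ⟨S, hS⟩
    obtain ⟨T, hST, hT⟩ := (Set.toFinite {U : Set V | U ⊆ farSet G X Y ∧ G.IsIndepSet U})
      |>.exists_le_maximal (a := S) ⟨hS.1, hS.2.1⟩
    refine ⟨X, Y, h, T, hT.1.2, isMaximalIndep_union_of_maximal h hS hST hT,
      isMaximalIndep_union_of_maximal h.symm (S := S) ?_ hST ?_⟩
    · rw [IsDominatingFar, farSet_comm, oneSidedSet_comm]; exact hS
    · rw [farSet_comm]; exact hT

end Domination

/-! ### The structure around a star -/

section Star

variable {V : Type*} {G : SimpleGraph V} {B Y : Set V} {x : V}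

theorem IsCompleteBipartition.subsingleton_or_subsingleton {X : Set V}
    (h : IsCompleteBipartition G B X Y) (h4 : (SimpleGraph.cycleGraph 4).Free G) :
    X.Subsingleton ∨ Y.Subsingleton := by
  by_contra! hne
  obtain ⟨⟨a, ha, b, hb, hab⟩, ⟨c, hc, d, hd, hcd⟩⟩ := hne
  have hac := h.adj a ha c hc
  have hbc := h.adj b hb c hc
  have hbd := h.adj b hb d hd
  have had := h.adj a ha d hd
  refine h4.not_four_cycle (a := a) (b := c) (c := b) (d := d) ?_ hac hbc.symm hbd had.symm
  have := hac.ne; have := hbc.ne; have := hbd.ne; have := had.ne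
  simp; and_intros <;> grind

theorem mem_oneSidedSet_singleton {m : V} : m ∈ oneSidedSet G {x} Y ↔
    m ≠ x ∧ m ∉ Y ∧ ¬ (G.Adj x m ↔ ∃ y ∈ Y, G.Adj y m) := by
  simp [oneSidedSet, HasNeighborIn, not_or, and_assoc]

theorem mem_farSet_singleton {w : V} : w ∈ farSet G {x} Y ↔
    w ≠ x ∧ w ∉ Y ∧ ¬ G.Adj x w ∧ ∀ y ∈ Y, ¬ G.Adj y w := by
  simp [farSet, HasNeighborIn, not_or, and_assoc]

/-- A far vertex has at most one neighbour among the one-sided vertices of each kind. -/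
theorem eq_of_adj_farSet (h : IsCompleteBipartition G B {x} Y)
    (h4 : (SimpleGraph.cycleGraph 4).Free G) (h6 : (SimpleGraph.cycleGraph 6).Free G)
    {w m m' : V} (hw : w ∈ farSet G {x} Y) (hm : m ∈ oneSidedSet G {x} Y)
    (hm' : m' ∈ oneSidedSet G {x} Y) (hwm : G.Adj w m) (hwm' : G.Adj w m')
    (hside : G.Adj x m ↔ G.Adj x m') : m = m' := by
  by_contra hne
  have hxY : x ∉ Y := fun hx => (Set.disjoint_left.1 h.disjoint) rfl hx
  rw [mem_oneSidedSet_singleton] at hm hm'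
  rw [mem_farSet_singleton] at hw
  have h1 := hwm.ne
  have h2 := hwm'.ne
  -- On the side of `x` this is the 4-cycle `x m w m'`. On the other side it is a 4-cycle through a
  -- common neighbour in `Y`, or the 6-cycle `x y m w m' y'`.
  by_cases hx : G.Adj x m
  · refine h4.not_four_cycle (a := x) (b := m) (c := w) (d := m') ?_ hx hwm.symm hwm'
      (hside.1 hx).symm
    simp; and_intros <;> grind
  · obtain ⟨y, hy, hym⟩ : ∃ y ∈ Y, G.Adj y m := by tauto
    obtain ⟨y', hy', hym'⟩ : ∃ y ∈ Y, G.Adj y m' := by tauto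
    by_cases hyy : y = y'
    · subst hyy
      refine h4.not_four_cycle (a := y) (b := m) (c := w) (d := m') ?_ hym hwm.symm hwm' hym'.symm
      simp; and_intros <;> grind
    · refine h6.not_six_cycle (a := x) (b := y) (c := m) (d := w) (e := m') (f := y') ?_
        (h.adj x rfl y hy) hym hwm.symm hwm' hym'.symm (h.adj x rfl y' hy').symm
      simp; and_intros <;> grind

/-- One-sided neighbours of two adjacent far vertices lie on the same side, at the same vertex
of the star. -/
theorem exists_common_root (h : IsCompleteBipartition G B {x} Y)
    (h6 : (SimpleGraph.cycleGraph 6).Free G) (h7 : (SimpleGraph.cycleGraph 7).Free G)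
    {w w' m m' : V} (hw : w ∈ farSet G {x} Y) (hw' : w' ∈ farSet G {x} Y)
    (hm : m ∈ oneSidedSet G {x} Y) (hm' : m' ∈ oneSidedSet G {x} Y) (hww : G.Adj w w')
    (hwm : G.Adj w m) (hwm' : G.Adj w' m') :
    (G.Adj x m ↔ G.Adj x m') ∧ ∃ r ∈ insert x Y, G.Adj r m ∧ G.Adj r m' := by
  have hxY : x ∉ Y := fun hx => (Set.disjoint_left.1 h.disjoint) rfl hx
  -- Different sides would close the 6-cycle `x m w w' m' y`.
  have key : ∀ {w w' m m' : V}, w ∈ farSet G {x} Y → w' ∈ farSet G {x} Y →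
      m ∈ oneSidedSet G {x} Y → m' ∈ oneSidedSet G {x} Y → G.Adj w w' →
      G.Adj w m → G.Adj w' m' → G.Adj x m → G.Adj x m' := by
    intro w w' m m' hw hw' hm hm' hww hwm hwm' hx
    by_contra hx'
    rw [mem_oneSidedSet_singleton] at hm hm'
    rw [mem_farSet_singleton] at hw hw'
    obtain ⟨y, hy, hym'⟩ : ∃ y ∈ Y, G.Adj y m' := by tauto
    refine h6.not_six_cycle (a := x) (b := m) (c := w) (d := w') (e := m') (f := y) ?_
      hx hwm.symm hww hwm' hym'.symm (h.adj x rfl y hy).symm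
    have := hww.ne; have := hwm.ne; have := hwm'.ne
    simp; and_intros <;> grind
  have hiff : G.Adj x m ↔ G.Adj x m' :=
    ⟨key hw hw' hm hm' hww hwm hwm', key hw' hw hm' hm hww.symm hwm' hwm⟩
  refine ⟨hiff, ?_⟩
  clear key
  by_cases hx : G.Adj x m
  · exact ⟨x, Or.inl rfl, hx, hiff.1 hx⟩
  · rw [mem_oneSidedSet_singleton] at hm hm'
    rw [mem_farSet_singleton] at hw hw'
    obtain ⟨y, hy, hym⟩ : ∃ y ∈ Y, G.Adj y m := by tauto
    obtain ⟨y', hy', hym'⟩ : ∃ y ∈ Y, G.Adj y m' := by tauto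
    by_cases hmm : m = m'
    · exact ⟨y, Or.inr hy, hym, hmm ▸ hym⟩
    by_cases hyy : y = y'
    · exact ⟨y, Or.inr hy, hym, hyy ▸ hym'⟩
    -- Different neighbours `y`, `y'` in `Y` would close a 7-cycle.
    · exfalso
      refine h7.not_seven_cycle (a := x) (b := y) (c := m) (d := w) (e := w') (f := m') (g := y') ?_
        (h.adj x rfl y hy) hym hwm.symm hww hwm' hym'.symm (h.adj x rfl y' hy').symm
      have := hww.ne; have := hwm.ne; have := hwm'.ne
      simp; and_intros <;> grind

/-- Far vertices with a one-sided neighbour have at most one such far vertex as a neighbour. -/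
theorem eq_of_adj_of_adj (h : IsCompleteBipartition G B {x} Y)
    (h4 : (SimpleGraph.cycleGraph 4).Free G) (h6 : (SimpleGraph.cycleGraph 6).Free G)
    (h7 : (SimpleGraph.cycleGraph 7).Free G) {w a b mw ma mb : V}
    (hw : w ∈ farSet G {x} Y) (ha : a ∈ farSet G {x} Y) (hb : b ∈ farSet G {x} Y)
    (hmw : mw ∈ oneSidedSet G {x} Y) (hma : ma ∈ oneSidedSet G {x} Y)
    (hmb : mb ∈ oneSidedSet G {x} Y) (hw1 : G.Adj w mw) (ha1 : G.Adj a ma) (hb1 : G.Adj b mb)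
    (hwa : G.Adj w a) (hwb : G.Adj w b) : a = b := by
  by_contra hab
  have hxY : x ∉ Y := fun hx => (Set.disjoint_left.1 h.disjoint) rfl hx
  obtain ⟨-, r, hr, hrw, hra⟩ := exists_common_root h h6 h7 hw ha hmw hma hwa hw1 ha1
  obtain ⟨-, r', hr', hrw', hrb⟩ := exists_common_root h h6 h7 hw hb hmw hmb hwb hw1 hb1
  have hne := hwa.ne
  have hne' := hwb.ne
  rw [mem_oneSidedSet_singleton] at hmw hma hmb
  rw [mem_farSet_singleton] at hw ha hb
  -- The vertex of the star next to `mw` is unique: it is `x` on the side of `x`, and two candidates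
  -- in `Y` would form a 4-cycle with `x` and `mw`.
  have hrr : r = r' := by
    by_contra hrr
    by_cases hx : G.Adj x mw
    · have hY : ∀ y ∈ Y, ¬ G.Adj y mw := fun y hy hym => hmw.2.2 (iff_of_true hx ⟨y, hy, hym⟩)
      rcases hr with rfl | hr
      · rcases hr' with rfl | hr'
        · exact hrr rfl
        · exact hY _ hr' hrw'
      · exact hY _ hr hrw
    · have hrY : r ∈ Y := hr.resolve_left fun hr => hx (hr ▸ hrw)
      have hrY' : r' ∈ Y := hr'.resolve_left fun hr => hx (hr ▸ hrw')
      refine h4.not_four_cycle (a := x) (b := r) (c := mw) (d := r') ?_ (h.adj x rfl r hrY) hrw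
        hrw'.symm (h.adj x rfl r' hrY').symm
      simp; and_intros <;> grind
  subst hrr
  have hra' : ∀ v, v ≠ x ∧ v ∉ Y → v ≠ r := by
    rintro v ⟨hvx, hvY⟩ rfl
    exact hr.elim hvx hvY
  have hfar : ∀ v, (¬ G.Adj x v ∧ ∀ y ∈ Y, ¬ G.Adj y v) → ¬ G.Adj r v := by
    rintro v ⟨hvx, hvY⟩
    rcases hr with rfl | hr
    · exact hvx
    · exact hvY r hr
  have e₁ := hra' w ⟨hw.1, hw.2.1⟩
  have e₂ := hra' a ⟨ha.1, ha.2.1⟩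
  have e₃ := hra' b ⟨hb.1, hb.2.1⟩
  have e₄ := hfar w hw.2.2
  have e₅ := hfar a ha.2.2
  have e₆ := hfar b hb.2.2
  have e₇ := hra.ne
  have e₈ := hrb.ne
  have e₉ := ha1.ne
  have e₁₀ := hb1.ne
  clear hra' hfar hw ha hb hmw hma hmb h hr hr'
  -- With a common root `r`, the path `a w b` closes to a 4-cycle at `ma = mb`, or to a 6-cycle
  -- through `ma`, `r` and `mb`.
  by_cases hmm : ma = mb
  · subst hmm
    refine h4.not_four_cycle (a := ma) (b := a) (c := w) (d := b) ?_ ha1.symm hwa.symm hwb hb1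
    simp; and_intros <;> grind
  · refine h6.not_six_cycle (a := r) (b := ma) (c := a) (d := w) (e := b) (f := mb) ?_ hra
      ha1.symm hwa.symm hwb hb1 hrb.symm
    simp; and_intros <;> grind

end Star

/-! ### Independent selections -/

section Selection

variable {V : Type*} {G : SimpleGraph V}

/-- A variable occurs in at most two clauses. By `h_deg`, two of `u`, `v`, `w` coincide. If all
three do, three neighbours lie on two sides; otherwise `h_edge` puts the two neighbours of the
repeated vertex on one side. -/
theorem eq_or_eq_or_eq_of_pairwise_adj {M W : Set V} (side : V → Prop)
    (h_side : ∀ w ∈ W, ∀ m ∈ M, ∀ m' ∈ M, G.Adj w m → G.Adj w m' → (side m ↔ side m') → m = m')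
    (h_edge : ∀ w ∈ W, ∀ w' ∈ W, ∀ m ∈ M, ∀ m' ∈ M, G.Adj w w' → G.Adj w m → G.Adj w' m' →
      (side m ↔ side m'))
    (h_deg : ∀ w ∈ W, ∀ a ∈ W, ∀ b ∈ W, ∀ m ∈ M, ∀ ma ∈ M, ∀ mb ∈ M, G.Adj w m → G.Adj a ma →
      G.Adj b mb → G.Adj w a → G.Adj w b → a = b)
    {u v w a b c : V} (hu : u ∈ W) (hv : v ∈ W) (hw : w ∈ W) (ha : a ∈ M) (hb : b ∈ M) (hc : c ∈ M)
    (hua : G.Adj u a) (hvb : G.Adj v b) (hwc : G.Adj w c) (hvu : v = u ∨ G.Adj v u)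
    (hwu : w = u ∨ G.Adj w u) (hvw : v = w ∨ G.Adj v w) : a = b ∨ a = c ∨ b = c := by
  rcases hvu with rfl | hvu
  · rcases hwu with rfl | hwu
    · have h₁ := h_side w hw a ha b hb hua hvb
      have h₂ := h_side w hw a ha c hc hua hwc
      have h₃ := h_side w hw b hb c hc hvb hwc
      clear h_side h_edge h_deg
      tauto
    · have h₁ := h_edge w hw v hv c hc a ha hwu hwc hua
      have h₂ := h_edge w hw v hv c hc b hb hwu hwc hvb
      exact Or.inl (h_side v hv a ha b hb hua hvb (h₁.symm.trans h₂))
  · rcases hwu with rfl | hwu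
    · have h₁ := h_edge v hv w hw b hb a ha hvu hvb hua
      have h₂ := h_edge v hv w hw b hb c hc hvu hvb hwc
      exact Or.inr (Or.inl (h_side w hw a ha c hc hua hwc (h₁.symm.trans h₂)))
    · rcases hvw with rfl | hvw
      · have h₁ := h_edge v hv u hu b hb a ha hvu hvb hua
        have h₂ := h_edge v hv u hu c hc a ha hvu hwc hua
        exact Or.inr (Or.inr (h_side v hv b hb c hc hvb hwc (h₁.trans h₂.symm)))
      · exact absurd (h_deg u hu v hv w hw a ha b hb c hc hua hvb hwc hvu.symm hwu.symm) hvw.ne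

/-- Let the vertices of `W` that have a neighbour in `M` induce a graph of maximum degree one, each
of them having at most one neighbour in `M` on each of two sides, and all neighbours in `M` of two
adjacent ones lying on the same side. If each `m ∈ M` with a single neighbour in `A ⊆ W` has a
neighbour in `A` that is isolated in `A`, then an independent subset of `A` dominates `M`. -/
theorem exists_indep_dominating [Finite V] {M W A : Set V} (side : V → Prop)
    (h_side : ∀ w ∈ W, ∀ m ∈ M, ∀ m' ∈ M, G.Adj w m → G.Adj w m' → (side m ↔ side m') → m = m')
    (h_edge : ∀ w ∈ W, ∀ w' ∈ W, ∀ m ∈ M, ∀ m' ∈ M, G.Adj w w' → G.Adj w m → G.Adj w' m' →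
      (side m ↔ side m'))
    (h_deg : ∀ w ∈ W, ∀ a ∈ W, ∀ b ∈ W, ∀ m ∈ M, ∀ ma ∈ M, ∀ mb ∈ M, G.Adj w m → G.Adj a ma →
      G.Adj b mb → G.Adj w a → G.Adj w b → a = b)
    (hAW : A ⊆ W) (h_ne : ∀ m ∈ M, ∃ w ∈ A, G.Adj m w)
    (h_single : ∀ m ∈ M, ∀ w ∈ A, G.Adj m w → (∀ u ∈ A, G.Adj m u → u = w) →
      ∀ u ∈ A, ¬ G.Adj w u) :
    ∃ S ⊆ A, G.IsIndepSet S ∧ ∀ m ∈ M, ∃ w ∈ S, G.Adj m w := by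
  classical
  have := Fintype.ofFinite V
  -- The label plays the role of the variable: `w` together with its partner in the matching.
  -- Partners with a common neighbour in `M` get separate labels; that neighbour is then the only
  -- one of either, so two clauses never select both.
  let lab : V → Set V := fun w => {u | u ∈ A ∧ (∃ m ∈ M, G.Adj m u) ∧
    (u = w ∨ (G.Adj u w ∧ ∀ m ∈ M, G.Adj m u → ¬ G.Adj m w))}
  have lab_sub : ∀ {u w mu mw}, u ∈ A → w ∈ A → mu ∈ M → mw ∈ M → G.Adj mu u → G.Adj mw w →
      G.Adj u w → (∀ m ∈ M, G.Adj m u → ¬ G.Adj m w) → lab u ⊆ lab w := by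
    rintro u w mu mw hu hw hmu hmw hmuu hmww huw hx z ⟨hz, ⟨mz, hmz, hmzz⟩, rfl | ⟨hzu, -⟩⟩
    · exact ⟨hz, ⟨mz, hmz, hmzz⟩, Or.inr ⟨huw, hx⟩⟩
    · have : z = w := h_deg u (hAW hu) z (hAW hz) w (hAW hw) mu hmu mz hmz mw hmw hmuu.symm
        hmzz.symm hmww.symm hzu.symm huw
      exact ⟨hz, ⟨mz, hmz, hmzz⟩, Or.inl this⟩
  have lab_eq : ∀ {u w mu mw}, u ∈ A → w ∈ A → mu ∈ M → mw ∈ M → G.Adj mu u → G.Adj mw w →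
      G.Adj u w → (∀ m ∈ M, G.Adj m u → ¬ G.Adj m w) → lab u = lab w := by
    intro u w mu mw hu hw hmu hmw hmuu hmww huw hx
    exact (lab_sub hu hw hmu hmw hmuu hmww huw hx).antisymm
      (lab_sub hw hu hmw hmu hmww hmuu huw.symm fun m hm h h' => hx m hm h' h)
  have of_lab_eq : ∀ {u w mu}, u ∈ A → mu ∈ M → G.Adj mu u → lab u = lab w →
      u = w ∨ (G.Adj u w ∧ ∀ m ∈ M, G.Adj m u → ¬ G.Adj m w) := by
    intro u w mu hu hmu hmuu hl
    have : u ∈ lab u := ⟨hu, ⟨mu, hmu, hmuu⟩, Or.inl rfl⟩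
    rw [hl] at this
    exact this.2.2
  -- By `h_ne`, these are the clauses with at least two literals.
  let ι := {m : V // m ∈ M ∧ ¬ ∃ w ∈ A, G.Adj m w ∧ ∀ u ∈ A, G.Adj m u → u = w}
  let t : ι → Finset (Set V) := fun m =>
    (Finset.univ.filter fun w => w ∈ A ∧ G.Adj m.1 w).image lab
  have mem_t : ∀ {m : ι} {l}, l ∈ t m ↔ ∃ w ∈ A, G.Adj m.1 w ∧ lab w = l := by
    intro m l; simp [t, and_assoc]
  have two_le : ∀ m : ι, 2 ≤ (t m).card := by
    rintro ⟨m, hm, hns⟩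
    obtain ⟨w, hw, hmw⟩ := h_ne m hm
    obtain ⟨u, hu, hmu, huw⟩ : ∃ u ∈ A, G.Adj m u ∧ u ≠ w := by
      by_contra! hcon
      exact hns ⟨w, hw, hmw, hcon⟩
    refine Finset.one_lt_card.2 ⟨lab u, mem_t.2 ⟨u, hu, hmu, rfl⟩, lab w,
      mem_t.2 ⟨w, hw, hmw, rfl⟩, fun hl => ?_⟩
    rcases of_lab_eq hu hm hmu hl with h | ⟨-, h⟩
    · exact huw h
    · exact h m hm hmu hmw
  have le_two : ∀ (s : Finset ι) (l : Set V), (s.filter fun m => l ∈ t m).card ≤ 2 := by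
    intro s l
    by_contra! hlt
    obtain ⟨⟨a, ha, _⟩, hal, ⟨b, hb, _⟩, hbl, ⟨c, hc, _⟩, hcl, hab, hac, hbc⟩ :=
      Finset.two_lt_card.1 hlt
    obtain ⟨u, hu, hau, hul⟩ := mem_t.1 (Finset.mem_filter.1 hal).2
    obtain ⟨v, hv, hbv, hvl⟩ := mem_t.1 (Finset.mem_filter.1 hbl).2
    obtain ⟨w, hw, hcw, hwl⟩ := mem_t.1 (Finset.mem_filter.1 hcl).2
    rcases eq_or_eq_or_eq_of_pairwise_adj side h_side h_edge h_deg (hAW hu) (hAW hv) (hAW hw)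
      ha hb hc hau.symm hbv.symm hcw.symm
      ((of_lab_eq hv hb hbv (hvl.trans hul.symm)).imp_right And.left)
      ((of_lab_eq hw hc hcw (hwl.trans hul.symm)).imp_right And.left)
      ((of_lab_eq hv hb hbv (hvl.trans hwl.symm)).imp_right And.left) with h | h | h
    · exact hab (Subtype.ext h)
    · exact hac (Subtype.ext h)
    · exact hbc (Subtype.ext h)
  -- Hall's condition by double counting: each clause has at least two labels, and each label lies
  -- in at most two clauses.
  obtain ⟨f, hf, hft⟩ := (Finset.all_card_le_biUnion_card_iff_exists_injective t).1 <| by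
    intro s
    have := Finset.card_mul_le_card_mul (s := s) (t := s.biUnion t) (fun m l => l ∈ t m)
      (m := 2) (n := 2) ?_ fun l _ => le_two s l
    · omega
    · intro m hm
      refine (two_le m).trans (Finset.card_le_card fun l hl => ?_)
      simp only [Finset.bipartiteAbove, Finset.mem_filter, Finset.mem_biUnion]
      exact ⟨⟨m, hm, hl⟩, hl⟩
  choose g hgA hgm hgl using fun m => mem_t.1 (hft m)
  refine ⟨{w | w ∈ A ∧ ∃ m ∈ M, G.Adj m w ∧ ∀ u ∈ A, G.Adj m u → u = w} ∪ Set.range g, ?_, ?_, ?_⟩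
  · rintro w (hw | ⟨m, rfl⟩)
    · exact hw.1
    · exact hgA m
  · have iso : ∀ {a b}, (a ∈ A ∧ ∃ m ∈ M, G.Adj m a ∧ ∀ u ∈ A, G.Adj m u → u = a) → b ∈ A →
        ¬ G.Adj a b := by
      rintro a b ⟨ha, m, hm, hma, hmu⟩ hb
      exact h_single m hm a ha hma hmu b hb
    rintro a ha b hb - hab
    rcases ha with ha | ⟨m, rfl⟩
    · refine iso ha ?_ hab
      rcases hb with hb | ⟨m, rfl⟩
      exacts [hb.1, hgA m]
    rcases hb with hb | ⟨m', rfl⟩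
    · exact iso hb (hgA m) hab.symm
    have hmm : m ≠ m' := by rintro rfl; exact hab.ne rfl
    -- Adjacent choices for different clauses have no common neighbour in `M`, since it would equal
    -- both clauses. Hence they carry the same label, against injectivity of `f`.
    refine hmm (hf ?_)
    rw [← hgl m, ← hgl m']
    refine lab_eq (hgA m) (hgA m') m.2.1 m'.2.1 (hgm m) (hgm m') hab fun p hp h₁ h₂ => ?_
    have e₁ := hAW (hgA m)
    have e₂ := hAW (hgA m')
    have s₃ := h_edge _ e₁ _ e₂ m m.2.1 p hp hab (hgm m).symm h₂.symm
    have s₂ := h_edge _ e₁ _ e₂ p hp m' m'.2.1 hab h₁.symm (hgm m').symm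
    have p₁ := h_side _ e₁ m m.2.1 p hp (hgm m).symm h₁.symm s₃
    have p₂ := h_side _ e₂ m' m'.2.1 p hp (hgm m').symm h₂.symm (s₂.symm)
    exact hmm (Subtype.ext (p₁.trans p₂.symm))
  · intro m hm
    by_cases hs : ∃ w ∈ A, G.Adj m w ∧ ∀ u ∈ A, G.Adj m u → u = w
    · obtain ⟨w, hw, hmw, hu⟩ := hs
      exact ⟨w, Or.inl ⟨hw, m, hm, hmw, hu⟩, hmw⟩
    · exact ⟨g ⟨m, hm, hs⟩, Or.inr ⟨_, rfl⟩, hgm ⟨m, hm, hs⟩⟩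

/-- If every one-sided vertex has a neighbour in the set `A` of far vertices, and single such
neighbours are isolated in `A`, then all one-sided vertices can be dominated. -/
theorem exists_isDominatingFar [Finite V] {B X Y A : Set V} (h : IsCompleteBipartition G B X Y)
    (h4 : (SimpleGraph.cycleGraph 4).Free G) (h6 : (SimpleGraph.cycleGraph 6).Free G)
    (h7 : (SimpleGraph.cycleGraph 7).Free G) (hA : A ⊆ farSet G X Y)
    (h_ne : ∀ m ∈ oneSidedSet G X Y, ∃ w ∈ A, G.Adj m w)
    (h_single : ∀ m ∈ oneSidedSet G X Y, ∀ w ∈ A, G.Adj m w → (∀ u ∈ A, G.Adj m u → u = w) →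
      ∀ u ∈ A, ¬ G.Adj w u) :
    ∃ S, IsDominatingFar G X Y S := by
  -- The lemmas on stars need a singleton on the left; the claim is symmetric in the two sides.
  wlog hX : X.Subsingleton generalizing X Y
  · obtain ⟨S, hS⟩ := this h.symm (by rwa [farSet_comm]) (by rwa [oneSidedSet_comm])
      (by rwa [oneSidedSet_comm]) ((h.subsingleton_or_subsingleton h4).resolve_left hX)
    refine ⟨S, ?_⟩
    rwa [IsDominatingFar, farSet_comm, oneSidedSet_comm] at hS
  obtain ⟨x, rfl⟩ : ∃ x, X = {x} := by
    obtain ⟨x, hx⟩ := h.nonempty_left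
    exact ⟨x, hX.eq_singleton_of_mem hx⟩
  obtain ⟨S, hSA, hSi, hSd⟩ := exists_indep_dominating (G.Adj x)
    (fun w hw m hm m' hm' hwm hwm' hs => eq_of_adj_farSet h h4 h6 hw hm hm' hwm hwm' hs)
    (fun w hw w' hw' m hm m' hm' hww hwm hwm' =>
      (exists_common_root h h6 h7 hw hw' hm hm' hww hwm hwm').1)
    (fun w hw a ha b hb m hm ma hma mb hmb h₁ h₂ h₃ h₄ h₅ =>
      eq_of_adj_of_adj h h4 h6 h7 hw ha hb hm hma hmb h₁ h₂ h₃ h₄ h₅)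
    hA h_ne h_single
  exact ⟨S, hSA.trans hA, hSi, hSd⟩

end Selection

/-! ### Running loop-free programs and scans of adjacency lists -/

namespace RAM

open Classical in
/-- The effect of a loop-free program. -/
noncomputable def Prog.den : Prog → State → State
  | .skip, s => s
  | .const r k, s => s.setReg r k
  | .copy r q, s => s.setReg r (s.reg q)
  | .succ r, s => s.setReg r (s.reg r + 1)
  | .pred r, s => s.setReg r (s.reg r - 1)
  | .load r a q, s => s.setReg r (s.arr a (s.reg q))
  | .store a q r, s => s.setArr a (s.reg q) (s.reg r)
  | .seq p p', s => p'.den (p.den s)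
  | .branch b p p', s => if b.holds s then p.den s else p'.den s
  | .loop _ _, s => s

/-- A bound for the number of steps of a loop-free program. -/
def Prog.cost : Prog → ℕ
  | .seq p p' => p.cost + p'.cost
  | .branch _ p p' => 1 + p.cost + p'.cost
  | _ => 1

/-- Loop-free programs that write neither to the control registers `0, …, 7` nor to the
arrays `0` and `1`, which hold the graph. -/
def Prog.isBody : Prog → Bool
  | .skip => true
  | .const r _ => 8 ≤ r
  | .copy r _ => 8 ≤ r
  | .succ r => 8 ≤ r
  | .pred r => 8 ≤ r
  | .load r _ _ => 8 ≤ r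
  | .store a _ _ => 2 ≤ a
  | .seq p p' => p.isBody && p'.isBody
  | .branch _ p p' => p.isBody && p'.isBody
  | .loop _ _ => false

theorem Prog.exec_den {p : Prog} (hp : p.isBody) (s : State) :
    ∃ t ≤ p.cost, Exec p s t (p.den s) := by
  induction p generalizing s with
  | skip => exact ⟨1, le_rfl, .skip s⟩
  | const r k => exact ⟨1, le_rfl, .const s r k⟩
  | copy r q => exact ⟨1, le_rfl, .copy s r q⟩
  | succ r => exact ⟨1, le_rfl, .succ s r⟩
  | pred r => exact ⟨1, le_rfl, .pred s r⟩
  | load r a q => exact ⟨1, le_rfl, .load s r a q⟩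
  | store a q r => exact ⟨1, le_rfl, .store s a q r⟩
  | seq p p' ih ih' =>
    simp only [isBody, Bool.and_eq_true] at hp
    obtain ⟨t, ht, h⟩ := ih hp.1 s
    obtain ⟨t', ht', h'⟩ := ih' hp.2 (p.den s)
    exact ⟨t + t', Nat.add_le_add ht ht', .seq h h'⟩
  | branch b p p' ih ih' =>
    simp only [isBody, Bool.and_eq_true] at hp
    by_cases hb : b.holds s
    · obtain ⟨t, ht, h⟩ := ih hp.1 s
      refine ⟨1 + t, by simp only [cost]; omega, ?_⟩
      rw [den, if_pos hb]
      exact .branch_true hb h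
    · obtain ⟨t, ht, h⟩ := ih' hp.2 s
      refine ⟨1 + t, by simp only [cost]; omega, ?_⟩
      rw [den, if_neg hb]
      exact .branch_false hb h
  | loop b p => simp [isBody] at hp

/-! ### What assignments and loop bodies leave unchanged. -/

theorem State.setReg_reg_of_ne (s : State) {r q x : ℕ} (h : q ≠ r) :
    (s.setReg r x).reg q = s.reg q := Function.update_of_ne h _ _

@[simp] theorem State.setReg_reg_self (s : State) (r x : ℕ) : (s.setReg r x).reg r = x :=
  Function.update_self _ _ _

@[simp] theorem State.setReg_arr (s : State) (r x : ℕ) : (s.setReg r x).arr = s.arr := rfl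

@[simp] theorem State.setArr_reg (s : State) (a i x : ℕ) : (s.setArr a i x).reg = s.reg := rfl

theorem State.setArr_arr_of_ne (s : State) {a b i x : ℕ} (h : b ≠ a) :
    (s.setArr a i x).arr b = s.arr b := Function.update_of_ne h _ _

theorem Prog.den_reg {p : Prog} (hp : p.isBody) (s : State) {r : ℕ} (hr : r < 8) :
    (p.den s).reg r = s.reg r := by
  induction p generalizing s with
  | skip | loop => rfl
  | const q | copy q | succ q | pred q | load q =>
    simp only [isBody, decide_eq_true_eq] at hp
    exact State.setReg_reg_of_ne _ (by omega)
  | store => rfl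
  | seq p p' ih ih' =>
    simp only [isBody, Bool.and_eq_true] at hp
    exact (ih' hp.2 _).trans (ih hp.1 s)
  | branch b p p' ih ih' =>
    simp only [isBody, Bool.and_eq_true] at hp
    rw [den]
    split_ifs
    exacts [ih hp.1 s, ih' hp.2 s]

theorem Prog.den_arr {p : Prog} (hp : p.isBody) (s : State) {a : ℕ} (ha : a < 2) :
    (p.den s).arr a = s.arr a := by
  induction p generalizing s with
  | skip | loop => rfl
  | const q | copy q | succ q | pred q | load q => rfl
  | store b =>
    simp only [isBody, decide_eq_true_eq] at hp
    exact State.setArr_arr_of_ne _ (by omega)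
  | seq p p' ih ih' =>
    simp only [isBody, Bool.and_eq_true] at hp
    exact (ih' hp.2 _).trans (ih hp.1 s)
  | branch b p p' ih ih' =>
    simp only [isBody, Bool.and_eq_true] at hp
    rw [den]
    split_ifs
    exacts [ih hp.1 s, ih' hp.2 s]

/-- The part of the memory that is used by loop bodies. -/
structure Data where
  root : ℕ
  count : ℕ
  last : ℕ
  fail : ℕ
  arr : ℕ → ℕ → ℕ

/-- The data part of a state. -/
def State.data (s : State) : Data := ⟨s.reg 8, s.reg 9, s.reg 10, s.reg 11, s.arr⟩

theorem State.data_setReg (s : State) {r : ℕ} (x : ℕ) (hr : r < 8) :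
    (s.setReg r x).data = s.data := by
  simp only [data, setReg_arr]
  rw [setReg_reg_of_ne, setReg_reg_of_ne, setReg_reg_of_ne, setReg_reg_of_ne] <;> omega

/-- Registers and arrays that are constant during a scan. -/
structure Ctx (n k : ℕ) (off adj : ℕ → ℕ) (s : State) : Prop where
  size : s.reg 0 = n
  zero : s.reg 5 = 0
  one : s.reg 6 = 1
  round : s.reg 7 = k
  off : s.arr 0 = off
  adj : s.arr 1 = adj

variable {n k : ℕ} {off adj : ℕ → ℕ} {L : ℕ → List ℕ}

theorem Ctx.setReg {s : State} (h : Ctx n k off adj s) {r : ℕ} (x : ℕ)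
    (hr : r ≠ 0 ∧ r ≠ 5 ∧ r ≠ 6 ∧ r ≠ 7) : Ctx n k off adj (s.setReg r x) := by
  obtain ⟨h0, h5, h6, h7⟩ := hr
  constructor
  · rw [State.setReg_reg_of_ne _ h0.symm, h.size]
  · rw [State.setReg_reg_of_ne _ h5.symm, h.zero]
  · rw [State.setReg_reg_of_ne _ h6.symm, h.one]
  · rw [State.setReg_reg_of_ne _ h7.symm, h.round]
  · exact h.off
  · exact h.adj

theorem Ctx.den {s : State} (h : Ctx n k off adj s) {p : Prog} (hp : p.isBody) :
    Ctx n k off adj (p.den s) := by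
  constructor
  · rw [Prog.den_reg hp _ (by omega), h.size]
  · rw [Prog.den_reg hp _ (by omega), h.zero]
  · rw [Prog.den_reg hp _ (by omega), h.one]
  · rw [Prog.den_reg hp _ (by omega), h.round]
  · rw [Prog.den_arr hp _ (by omega), h.off]
  · rw [Prog.den_arr hp _ (by omega), h.adj]

/-- The arrays `off` and `adj` store the lists `L 0, …, L (n - 1)` one after the other. -/
structure Stores (n : ℕ) (L : ℕ → List ℕ) (off adj : ℕ → ℕ) : Prop where
  off_zero : off 0 = 0
  off_succ : ∀ v < n, off (v + 1) = off v + (L v).length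
  adj_eq : ∀ v < n, ∀ i (h : i < (L v).length), adj (off v + i) = (L v)[i]

/-- Run `body` for all entries of a list: register `2` is the position, register `3` the end of
the list and register `4` the current entry. -/
def listLoop (body : Prog) : Prog :=
  .loop (.lt 2 3) (.seq (.load 4 1 2) (.seq body (.succ 2)))

/-- For all vertices `v`, in register `1`, run `pre`, then `body` for all neighbours of `v`, and
then `post`. -/
def scan (pre body post : Prog) : Prog :=
  .seq (.const 1 0) (.loop (.lt 1 0) (.seq pre (.seq (.load 2 0 1) (.seq (.succ 1)
    (.seq (.load 3 0 1) (.seq (.pred 1) (.seq (listLoop body) (.seq post (.succ 1)))))))))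

theorem exec_listLoop (hL : Stores n L off adj) {body : Prog} (hb : body.isBody) {v : ℕ}
    (hv : v < n) (I : List ℕ → Data → Prop)
    (h_body : ∀ s l u, Ctx n k off adj s → l ++ [u] <+: L v → s.reg 1 = v → s.reg 4 = u →
      I l s.data → I (l ++ [u]) (body.den s).data)
    (rest : List ℕ) : ∀ (s : State) (l : List ℕ), Ctx n k off adj s → l ++ rest = L v →
      s.reg 1 = v → s.reg 2 = off v + l.length → s.reg 3 = off (v + 1) → I l s.data →
      ∃ t s', Exec (listLoop body) s t s' ∧ t ≤ (body.cost + 3) * rest.length + 1 ∧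
        Ctx n k off adj s' ∧ s'.reg 1 = v ∧ I (L v) s'.data := by
  induction rest with
  | nil =>
    intro s l hs hl h1 h2 h3 hI
    refine ⟨1, s, .loop_false ?_, by simp, hs, h1, ?_⟩
    · simp only [List.append_nil] at hl
      simp only [Test.holds, h2, h3, hL.off_succ v hv, hl]
      omega
    · simp only [List.append_nil] at hl
      rwa [← hl]
  | cons u rest ih =>
    intro s l hs hl h1 h2 h3 hI
    have hlen : l.length < (L v).length := by rw [← hl]; simp
    have hu : s.arr 1 (s.reg 2) = u := by
      rw [hs.adj, h2, hL.adj_eq v hv _ hlen]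
      simp [← hl]
    have hs₁ : Ctx n k off adj (s.setReg 4 u) := hs.setReg u (by decide)
    obtain ⟨t, ht, hexec⟩ := body.exec_den hb (s.setReg 4 u)
    have hs₂ := hs₁.den hb
    have hpre : l ++ [u] <+: L v := ⟨rest, by rw [← hl]; simp⟩
    have hI₂ := h_body (s.setReg 4 u) l u hs₁ hpre
      (by rw [State.setReg_reg_of_ne _ (by decide), h1]) (by simp)
      (by rwa [State.data_setReg _ _ (by decide)])
    have hr : ∀ r, r < 8 → r ≠ 4 → (body.den (s.setReg 4 u)).reg r = s.reg r := fun r h8 h4 => by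
      rw [Prog.den_reg hb _ h8, State.setReg_reg_of_ne _ h4]
    set s₂ := body.den (s.setReg 4 u)
    obtain ⟨t', s', hexec', ht', hs', h1', hI'⟩ := ih (s₂.setReg 2 (s₂.reg 2 + 1)) (l ++ [u])
      (hs₂.setReg _ (by decide)) (by rw [← hl]; simp)
      (by rw [State.setReg_reg_of_ne _ (by decide), hr 1 (by decide) (by decide), h1])
      (by rw [State.setReg_reg_self, hr 2 (by decide) (by decide), h2]; simp; omega)
      (by rw [State.setReg_reg_of_ne _ (by decide), hr 3 (by decide) (by decide), h3])
      (by rwa [State.data_setReg _ _ (by decide)])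
    -- The overhead of 3 per entry is the test, the load and the increment.
    refine ⟨1 + (1 + (t + 1)) + t', s', .loop_true ?_ (.seq ?_ (.seq hexec (.succ _ _))) hexec',
      ?_, hs', h1', hI'⟩
    · simp only [Test.holds, h2, h3, hL.off_succ v hv]
      omega
    · have := Exec.load s 4 1 2
      rwa [hu] at this
    · simp only [List.length_cons, Nat.mul_succ]
      omega

theorem exec_vertexStep (hL : Stores n L off adj) {pre body post : Prog} (hpre : pre.isBody)
    (hbody : body.isBody) (hpost : post.isBody) (J : ℕ → Data → Prop)
    (I : ℕ → List ℕ → Data → Prop)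
    (h_pre : ∀ s v, v < n → Ctx n k off adj s → s.reg 1 = v → J v s.data →
      I v [] (pre.den s).data)
    (h_body : ∀ s v l u, v < n → Ctx n k off adj s → l ++ [u] <+: L v → s.reg 1 = v →
      s.reg 4 = u → I v l s.data → I v (l ++ [u]) (body.den s).data)
    (h_post : ∀ s v, v < n → Ctx n k off adj s → s.reg 1 = v → I v (L v) s.data →
      J (v + 1) (post.den s).data)
    {s : State} {v : ℕ} (hv : v < n) (hs : Ctx n k off adj s) (h1 : s.reg 1 = v)
    (hJ : J v s.data) :
    ∃ t s', Exec (.seq pre (.seq (.load 2 0 1) (.seq (.succ 1)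
      (.seq (.load 3 0 1) (.seq (.pred 1) (.seq (listLoop body) (.seq post (.succ 1)))))))) s t s' ∧
      t ≤ (pre.cost + body.cost + post.cost + 6) * (1 + (L v).length) ∧
      Ctx n k off adj s' ∧ s'.reg 1 = v + 1 ∧ J (v + 1) s'.data := by
  obtain ⟨t₁, ht₁, hexec₁⟩ := pre.exec_den hpre s
  have hI := h_pre s v hv hs h1 hJ
  have hs₁ := hs.den hpre
  have h1₁ : (pre.den s).reg 1 = v := by rw [Prog.den_reg hpre _ (by decide), h1]
  set s₁ := pre.den s
  let s₂ := s₁.setReg 2 (s₁.arr 0 (s₁.reg 1))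
  -- The vertex register is raised to `v + 1` only to read where the list of `v` ends, and is then
  -- restored.
  let s₃ := s₂.setReg 1 (s₂.reg 1 + 1)
  let s₄ := s₃.setReg 3 (s₃.arr 0 (s₃.reg 1))
  let s₅ := s₄.setReg 1 (s₄.reg 1 - 1)
  have h1₂ : s₂.reg 1 = v := (State.setReg_reg_of_ne _ (by decide)).trans h1₁
  have h1₃ : s₃.reg 1 = v + 1 := (State.setReg_reg_self _ _ _).trans (by rw [h1₂])
  have h1₄ : s₄.reg 1 = v + 1 := (State.setReg_reg_of_ne _ (by decide)).trans h1₃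
  have h1₅ : s₅.reg 1 = v := (State.setReg_reg_self _ _ _).trans (by rw [h1₄]; rfl)
  have h2 : s₅.reg 2 = off v := by
    have : s₂.reg 2 = off v := (State.setReg_reg_self _ _ _).trans (by rw [hs₁.off, h1₁])
    rw [← this]
    exact (State.setReg_reg_of_ne _ (by decide)).trans
      ((State.setReg_reg_of_ne _ (by decide)).trans (State.setReg_reg_of_ne _ (by decide)))
  have h3 : s₅.reg 3 = off (v + 1) := by
    refine (State.setReg_reg_of_ne _ (by decide)).trans ((State.setReg_reg_self _ _ _).trans ?_)
    rw [h1₃]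
    exact congrFun hs₁.off (v + 1)
  have hs₅ : Ctx n k off adj s₅ := (((hs₁.setReg _ (by decide)).setReg _ (by decide)).setReg _
    (by decide)).setReg _ (by decide)
  have hd₅ : s₅.data = s₁.data := by
    simp only [s₅, s₄, s₃, s₂]
    rw [State.data_setReg _ _ (by decide), State.data_setReg _ _ (by decide),
      State.data_setReg _ _ (by decide), State.data_setReg _ _ (by decide)]
  obtain ⟨t₂, s₆, hexec₂, ht₂, hs₆, h1₆, hI₆⟩ := exec_listLoop hL hbody hv (I v)
    (fun s l u hs hl h1 h4 h => h_body s v l u hv hs hl h1 h4 h) (L v) s₅ [] hs₅ rfl h1₅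
    (by simp [h2]) h3 (by rwa [hd₅])
  obtain ⟨t₃, ht₃, hexec₃⟩ := post.exec_den hpost s₆
  have hJ' := h_post s₆ v hv hs₆ h1₆ hI₆
  refine ⟨_, _, .seq hexec₁ (.seq (.load _ _ _ _) (.seq (.succ _ _) (.seq (.load _ _ _ _)
    (.seq (.pred _ _) (.seq hexec₂ (.seq hexec₃ (.succ _ _))))))), ?_,
    (hs₆.den hpost).setReg _ (by decide), ?_, ?_⟩
  -- The constant 6 counts the two loads, the increment and decrement around them, the final test of
  -- the inner loop and the last increment.
  · have : (body.cost + 3) * (L v).length ≤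
        (pre.cost + body.cost + post.cost + 6) * (L v).length := Nat.mul_le_mul_right _ (by omega)
    rw [Nat.mul_add, Nat.mul_one]
    omega
  · rw [State.setReg_reg_self, Prog.den_reg hpost _ (by decide), h1₆]
  · rwa [State.data_setReg _ _ (by decide)]

/-- The invariant rule for scans, with a time bound. -/
theorem exec_scan (hL : Stores n L off adj) {pre body post : Prog} (hpre : pre.isBody)
    (hbody : body.isBody) (hpost : post.isBody) (J : ℕ → Data → Prop)
    (I : ℕ → List ℕ → Data → Prop)
    (h_pre : ∀ s v, v < n → Ctx n k off adj s → s.reg 1 = v → J v s.data →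
      I v [] (pre.den s).data)
    (h_body : ∀ s v l u, v < n → Ctx n k off adj s → l ++ [u] <+: L v → s.reg 1 = v →
      s.reg 4 = u → I v l s.data → I v (l ++ [u]) (body.den s).data)
    (h_post : ∀ s v, v < n → Ctx n k off adj s → s.reg 1 = v → I v (L v) s.data →
      J (v + 1) (post.den s).data)
    {s : State} (hs : Ctx n k off adj s) (hJ : J 0 s.data) :
    ∃ t s', Exec (scan pre body post) s t s' ∧
      t ≤ (pre.cost + body.cost + post.cost + 7) * (n + off n) + 2 ∧
      Ctx n k off adj s' ∧ J n s'.data := by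
  set C := pre.cost + body.cost + post.cost + 6 with hC
  -- The quantity `v + off v` serves as a potential: processing `v` raises it by one plus the length
  -- of its list, so the costs telescope. The extra 1 in `C + 1` pays for the outer test.
  have key : ∀ d s v, v + d = n → Ctx n k off adj s → s.reg 1 = v → J v s.data →
      ∃ t s', Exec (.loop (.lt 1 0) (.seq pre (.seq (.load 2 0 1) (.seq (.succ 1)
        (.seq (.load 3 0 1) (.seq (.pred 1) (.seq (listLoop body) (.seq post (.succ 1)))))))))
        s t s' ∧ t + (C + 1) * (v + off v) ≤ (C + 1) * (n + off n) + 1 ∧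
        Ctx n k off adj s' ∧ J n s'.data := by
    intro d
    induction d with
    | zero =>
      intro s v hv hs h1 hJ
      obtain rfl : v = n := by omega
      exact ⟨1, s, .loop_false (by simp [Test.holds, h1, hs.size]), by omega, hs, hJ⟩
    | succ d ih =>
      intro s v hv hs h1 hJ
      have hvn : v < n := by omega
      obtain ⟨t, s', hexec, ht, hs', h1', hJ'⟩ :=
        exec_vertexStep hL hpre hbody hpost J I h_pre h_body h_post hvn hs h1 hJ
      obtain ⟨t', s'', hexec', ht', hs'', hJ''⟩ := ih s' (v + 1) (by omega) hs' h1' hJ'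
      refine ⟨_, s'', .loop_true (by simpa [Test.holds, h1, hs.size] using hvn) hexec hexec', ?_,
        hs'', hJ''⟩
      rw [hL.off_succ v hvn] at ht'
      rw [← hC] at ht
      have e : (C + 1) * (v + 1 + (off v + (L v).length)) =
          (C + 1) * (v + off v) + C * (1 + (L v).length) + (1 + (L v).length) := by ring
      omega
  obtain ⟨t, s', hexec, ht, hs', hJ'⟩ := key n (s.setReg 1 0) 0 (by omega)
    (hs.setReg _ (by decide)) (by simp) (by rwa [State.data_setReg _ _ (by decide)])
  refine ⟨_, s', .seq (.const _ _ _) hexec, ?_, hs', hJ'⟩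
  have e : pre.cost + body.cost + post.cost + 7 = C + 1 := rfl
  rw [e]
  omega

end RAM

/-! ### The program -/

namespace RAM

/-- Register `8` becomes a vertex of `B`. -/
def findRoot : Prog :=
  scan .skip .skip (.seq (.load 12 2 1) (.branch (.eq 12 6) (.copy 8 1) .skip))

/-- Array `3` becomes the characteristic vector of the neighbourhood of the root. -/
def markRoot : Prog :=
  scan .skip (.branch (.eq 1 8) (.store 3 4 6) .skip) .skip

/-- Arrays `4` and `5` become the characteristic vectors of the neighbourhoods of the side of the
root and of the other side. -/
def markSides : Prog :=
  scan .skip (.seq (.load 12 2 1) (.branch (.eq 12 6)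
    (.seq (.load 12 3 1) (.branch (.eq 12 6) (.store 5 4 6) (.store 4 4 6))) .skip)) .skip

/-- Arrays `6` and `7` become the characteristic vectors of the far vertices and of the one-sided
vertices. -/
def classify : Prog :=
  scan .skip .skip (.seq (.load 12 2 1) (.branch (.eq 12 6) .skip
    (.seq (.load 12 4 1) (.seq (.load 13 5 1) (.branch (.eq 12 13)
      (.branch (.eq 12 5) (.store 6 1 6) .skip) (.store 7 1 6))))))

/-- Record in array `8` the vertices that are the only available neighbour of a one-sided vertex,
and in register `11` whether a one-sided vertex has no available neighbour. -/
def collect : Prog :=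
  scan (.const 9 0)
    (.seq (.load 12 6 4) (.branch (.eq 12 6) (.seq (.succ 9) (.copy 10 4)) .skip))
    (.seq (.load 12 7 1) (.branch (.eq 12 6) (.branch (.eq 9 5) (.const 11 1)
      (.branch (.eq 9 6) (.store 8 10 6) .skip)) .skip))

/-- Make the neighbours of the vertices in array `8` unavailable. -/
def discard : Prog :=
  scan .skip (.seq (.load 12 8 1) (.branch (.eq 12 6) (.store 6 4 5) .skip)) .skip

/-- Unit propagation, once for each vertex. -/
def propagate : Prog :=
  .seq (.const 7 0) (.loop (.lt 7 0) (.seq (.seq collect discard) (.succ 7)))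

/-- The decision procedure. -/
def decideGenerating : Prog :=
  .seq (.const 6 1) (.seq findRoot (.seq markRoot (.seq markSides (.seq classify
    (.seq propagate (.seq collect (.branch (.eq 11 5) (.const 0 1) (.const 0 0))))))))

/-! ### Its effect on the arrays -/

open Classical in
/-- The characteristic vector of a predicate. -/
noncomputable def ind (p : ℕ → Prop) : ℕ → ℕ := fun i => if p i then 1 else 0

open Classical in
/-- The truth value of a proposition as a number. -/
noncomputable def truthValue (p : Prop) : ℕ := if p then 1 else 0

theorem truthValue_of {p : Prop} (h : p) : truthValue p = 1 := if_pos h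

theorem truthValue_of_not {p : Prop} (h : ¬ p) : truthValue p = 0 := if_neg h

theorem ind_eq_one {p : ℕ → Prop} {i : ℕ} : ind p i = 1 ↔ p i := by simp [ind]

theorem ind_eq_zero {p : ℕ → Prop} {i : ℕ} : ind p i = 0 ↔ ¬ p i := by simp [ind]

theorem update_ind_one (p : ℕ → Prop) (u : ℕ) :
    Function.update (ind p) u 1 = ind fun i => p i ∨ i = u := by
  funext i
  by_cases h : i = u
  · simp [ind, h]
  · by_cases hp : p i <;> simp [ind, h, hp]

theorem update_ind_zero (p : ℕ → Prop) (u : ℕ) :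
    Function.update (ind p) u 0 = ind fun i => p i ∧ i ≠ u := by
  funext i
  by_cases h : i = u
  · simp [ind, h]
  · by_cases hp : p i <;> simp [ind, h, hp]

/-- The entries of the lists of the vertices below `v` that satisfy `R`, together with `l` if `v`
satisfies `R`. -/
def Seen (L : ℕ → List ℕ) (R : ℕ → Prop) (v : ℕ) (l : List ℕ) (u : ℕ) : Prop :=
  (∃ w < v, R w ∧ u ∈ L w) ∨ (R v ∧ u ∈ l)

section Seen

variable {L : ℕ → List ℕ} {R : ℕ → Prop}

theorem seen_append_of {v u : ℕ} (l : List ℕ) (h : R v) :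
    Seen L R v (l ++ [u]) = fun i => Seen L R v l i ∨ i = u := by
  funext i; simp [Seen, h, or_assoc]

theorem update_ind_seen {v u : ℕ} {l : List ℕ} (h : R v) :
    Function.update (ind (Seen L R v l)) u 1 = ind (Seen L R v (l ++ [u])) := by
  rw [update_ind_one, seen_append_of l h]

theorem seen_append_of_not {v : ℕ} (l l' : List ℕ) (h : ¬ R v) :
    Seen L R v (l ++ l') = Seen L R v l := by
  funext i; simp [Seen, h]

/-- Finishing one list is the same as starting the next, so marking scans need no work between
lists. -/
theorem seen_done (v : ℕ) : Seen L R v (L v) = Seen L R (v + 1) [] := by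
  funext i
  simp only [Seen, List.not_mem_nil, and_false, or_false, Nat.lt_succ_iff_lt_or_eq, eq_iff_iff]
  constructor
  · rintro (⟨w, hw, h⟩ | h)
    exacts [⟨w, Or.inl hw, h⟩, ⟨v, Or.inr rfl, h⟩]
  · rintro ⟨w, hw | rfl, h⟩
    exacts [Or.inl ⟨w, hw, h⟩, Or.inr h]

theorem seen_zero : Seen L R 0 [] = fun _ => False := by
  funext i; simp [Seen]

theorem seen_nil {v u : ℕ} : Seen L R v [] u ↔ ∃ w < v, R w ∧ u ∈ L w := by
  simp [Seen]

end Seen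

/-- The arrays `2, …, 8` are the characteristic vectors of the given predicates. -/
structure Tables (b r ax ay av im fo : ℕ → Prop) (d : Data) : Prop where
  arr_two : d.arr 2 = ind b
  arr_three : d.arr 3 = ind r
  arr_four : d.arr 4 = ind ax
  arr_five : d.arr 5 = ind ay
  arr_six : d.arr 6 = ind av
  arr_seven : d.arr 7 = ind im
  arr_eight : d.arr 8 = ind fo

namespace Tables

variable {b r ax ay av im fo p : ℕ → Prop} {s : State} {d : Data} {i x : ℕ}

theorem of_arr_eq (h : Tables b r ax ay av im fo d) {d' : Data} (hd : d'.arr = d.arr) :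
    Tables b r ax ay av im fo d' := by
  obtain ⟨h2, h3, h4, h5, h6, h7, h8⟩ := h
  constructor <;> rwa [hd]

theorem setArr_three (h : Tables b r ax ay av im fo s.data)
    (hp : Function.update (ind r) i x = ind p) :
    Tables b p ax ay av im fo (s.setArr 3 i x).data := by
  obtain ⟨h2, h3, h4, h5, h6, h7, h8⟩ := h
  constructor <;> simp_all [State.data, State.setArr]

theorem setArr_four (h : Tables b r ax ay av im fo s.data)
    (hp : Function.update (ind ax) i x = ind p) :
    Tables b r p ay av im fo (s.setArr 4 i x).data := by
  obtain ⟨h2, h3, h4, h5, h6, h7, h8⟩ := h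
  constructor <;> simp_all [State.data, State.setArr]

theorem setArr_five (h : Tables b r ax ay av im fo s.data)
    (hp : Function.update (ind ay) i x = ind p) :
    Tables b r ax p av im fo (s.setArr 5 i x).data := by
  obtain ⟨h2, h3, h4, h5, h6, h7, h8⟩ := h
  constructor <;> simp_all [State.data, State.setArr]

theorem setArr_six (h : Tables b r ax ay av im fo s.data)
    (hp : Function.update (ind av) i x = ind p) :
    Tables b r ax ay p im fo (s.setArr 6 i x).data := by
  obtain ⟨h2, h3, h4, h5, h6, h7, h8⟩ := h
  constructor <;> simp_all [State.data, State.setArr]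

theorem setArr_seven (h : Tables b r ax ay av im fo s.data)
    (hp : Function.update (ind im) i x = ind p) :
    Tables b r ax ay av p fo (s.setArr 7 i x).data := by
  obtain ⟨h2, h3, h4, h5, h6, h7, h8⟩ := h
  constructor <;> simp_all [State.data, State.setArr]

theorem setArr_eight (h : Tables b r ax ay av im fo s.data)
    (hp : Function.update (ind fo) i x = ind p) :
    Tables b r ax ay av im p (s.setArr 8 i x).data := by
  obtain ⟨h2, h3, h4, h5, h6, h7, h8⟩ := h
  constructor <;> simp_all [State.data, State.setArr]

end Tables

/-- `p` halts in a state with property `Q` after at most `T` steps. -/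
def RunsIn (p : Prog) (s : State) (T : ℕ) (Q : State → Prop) : Prop :=
  ∃ t s', Exec p s t s' ∧ t ≤ T ∧ Q s'

theorem RunsIn.seq {p p' : Prog} {s : State} {T T' : ℕ} {Q Q' : State → Prop}
    (h : RunsIn p s T Q) (h' : ∀ s', Q s' → RunsIn p' s' T' Q') :
    RunsIn (.seq p p') s (T + T') Q' := by
  obtain ⟨t, s', he, ht, hQ⟩ := h
  obtain ⟨t', s'', he', ht', hQ'⟩ := h' s' hQ
  exact ⟨_, s'', .seq he he', Nat.add_le_add ht ht', hQ'⟩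

theorem RunsIn.mono {p : Prog} {s : State} {T T' : ℕ} {Q Q' : State → Prop}
    (h : RunsIn p s T Q) (hT : T ≤ T') (hQ : ∀ s', Q s' → Q' s') : RunsIn p s T' Q' := by
  obtain ⟨t, s', he, ht, h⟩ := h
  exact ⟨t, s', he, ht.trans hT, hQ s' h⟩

/-! ### Specifications of the individual scans. -/

variable {n k : ℕ} {off adj : ℕ → ℕ} {L : ℕ → List ℕ}

/-- The number 23 is a common, not sharp, bound for the loop-free parts; with the overhead 7 of
`exec_scan` it makes 30. -/
theorem runsIn_scan (hL : Stores n L off adj) {pre body post : Prog} (hpre : pre.isBody)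
    (hbody : body.isBody) (hpost : post.isBody) (J : ℕ → Data → Prop)
    (I : ℕ → List ℕ → Data → Prop) (hcost : pre.cost + body.cost + post.cost ≤ 23)
    (h_pre : ∀ s v, v < n → Ctx n k off adj s → s.reg 1 = v → J v s.data →
      I v [] (pre.den s).data)
    (h_body : ∀ s v l u, v < n → Ctx n k off adj s → l ++ [u] <+: L v → s.reg 1 = v →
      s.reg 4 = u → I v l s.data → I v (l ++ [u]) (body.den s).data)
    (h_post : ∀ s v, v < n → Ctx n k off adj s → s.reg 1 = v → I v (L v) s.data →
      J (v + 1) (post.den s).data)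
    {s : State} (hs : Ctx n k off adj s) (hJ : J 0 s.data) :
    RunsIn (scan pre body post) s (30 * (n + off n) + 2)
      fun s' => Ctx n k off adj s' ∧ J n s'.data := by
  obtain ⟨t, s', he, ht, h⟩ := exec_scan hL hpre hbody hpost J I h_pre h_body h_post hs hJ
  exact ⟨t, s', he, ht.trans (Nat.add_le_add_right (Nat.mul_le_mul_right _ (by omega)) _), h⟩

variable {b r ax ay av im fo : ℕ → Prop}

theorem runsIn_findRoot (hL : Stores n L off adj) {s : State} (hs : Ctx n k off adj s)
    (ht : Tables b r ax ay av im fo s.data) (hf : s.data.fail = 0) (hb : ∃ v < n, b v) :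
    RunsIn findRoot s (30 * (n + off n) + 2) fun s' => Ctx n k off adj s' ∧
      Tables b r ax ay av im fo s'.data ∧ s'.data.fail = 0 ∧ b s'.data.root := by
  refine (runsIn_scan hL rfl rfl rfl
    -- The root is constrained only after a vertex of `b` has been met; its initial value is
    -- arbitrary.
    (fun v d => Tables b r ax ay av im fo d ∧ d.fail = 0 ∧ ((∃ w < v, b w) → b d.root))
    (fun v _ d => Tables b r ax ay av im fo d ∧ d.fail = 0 ∧ ((∃ w < v, b w) → b d.root))
    (by decide) ?_ ?_ ?_ hs ⟨ht, hf, by simp⟩).mono le_rfl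
    fun s' h => ⟨h.1, h.2.1, h.2.2.1, h.2.2.2 hb⟩
  · intro s v _ _ _ h; exact h
  · intro s v l u _ _ _ _ _ h; exact h
  · rintro s v - hs h1 ⟨ht, hf, hr⟩
    have e2 := ht.arr_two
    obtain ⟨t2, t3, t4, t5, t6, t7, t8⟩ := ht
    simp only [State.data] at *
    by_cases hv : b v
    · have : s.arr 2 v = 1 := by rw [e2, ind_eq_one]; exact hv
      simp [Prog.den, Test.holds, State.setReg, h1, hs.one, this, hf, hv]
      constructor <;> assumption
    · have : s.arr 2 v ≠ 1 := by rw [e2, ne_eq, ind_eq_one]; exact hv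
      simp [Prog.den, Test.holds, State.setReg, h1, hs.one, this, hf]
      refine ⟨by constructor <;> assumption, fun w hw hbw => hr ⟨w, ?_, hbw⟩⟩
      rcases Nat.le_iff_lt_or_eq.1 hw with hw | rfl
      exacts [hw, absurd hbw hv]


theorem runsIn_markRoot (hL : Stores n L off adj) {s : State} (hs : Ctx n k off adj s)
    {root : ℕ} (ht : Tables b (fun _ => False) ax ay av im fo s.data) (hf : s.data.fail = 0)
    (hr : s.data.root = root) :
    RunsIn markRoot s (30 * (n + off n) + 2) fun s' => Ctx n k off adj s' ∧
      Tables b (Seen L (· = root) n []) ax ay av im fo s'.data ∧ s'.data.fail = 0 := by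
  let I : ℕ → List ℕ → Data → Prop := fun v l d =>
    Tables b (Seen L (· = root) v l) ax ay av im fo d ∧ d.fail = 0 ∧ d.root = root
  refine (runsIn_scan hL rfl rfl rfl (fun v => I v []) I (by decide) ?_ ?_ ?_ hs
    ⟨by rwa [seen_zero], hf, hr⟩).mono le_rfl fun s' h => ⟨h.1, h.2.1, h.2.2.1⟩
  · intro s v _ _ _ h; exact h
  · rintro s v l u - hs - h1 h4 ⟨ht, hf, hr⟩
    have h8 : s.reg 8 = root := hr
    by_cases hv : v = root
    · have e : (Prog.branch (.eq 1 8) (.store 3 4 6) .skip).den s = s.setArr 3 u 1 := by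
        simp [Prog.den, Test.holds, h1, h8, hv, h4, hs.one]
      rw [e]
      exact ⟨ht.setArr_three (update_ind_seen hv), hf, hr⟩
    · have e : (Prog.branch (.eq 1 8) (.store 3 4 6) .skip).den s = s := by
        simp [Prog.den, Test.holds, h1, h8, hv]
      rw [e]
      exact ⟨by rwa [seen_append_of_not (R := (· = root)) l [u] hv], hf, hr⟩
  · rintro s v - - - ⟨ht, h⟩
    exact ⟨by rwa [← seen_done], h⟩

theorem runsIn_markSides (hL : Stores n L off adj) {s : State} (hs : Ctx n k off adj s)
    (ht : Tables b r (fun _ => False) (fun _ => False) av im fo s.data) (hf : s.data.fail = 0) :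
    RunsIn markSides s (30 * (n + off n) + 2) fun s' => Ctx n k off adj s' ∧
      Tables b r (Seen L (fun v => b v ∧ ¬ r v) n []) (Seen L (fun v => b v ∧ r v) n [])
        av im fo s'.data ∧ s'.data.fail = 0 := by
  let I : ℕ → List ℕ → Data → Prop := fun v l d =>
    Tables b r (Seen L (fun v => b v ∧ ¬ r v) v l) (Seen L (fun v => b v ∧ r v) v l) av im fo d ∧
      d.fail = 0
  refine runsIn_scan hL rfl rfl rfl (fun v => I v []) I (by decide) ?_ ?_ ?_ hs
    ⟨by rwa [seen_zero, seen_zero], hf⟩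
  · intro s v _ _ _ h; exact h
  · rintro s v l u - hs - h1 h4 ⟨ht, hf⟩
    have h2 : s.arr 2 = ind b := ht.arr_two
    have h3 : s.arr 3 = ind r := ht.arr_three
    have hx : ¬ (b v ∧ ¬ r v) → Seen L (fun v => b v ∧ ¬ r v) v (l ++ [u]) = _ :=
      seen_append_of_not (R := fun v => b v ∧ ¬ r v) l [u]
    have hy : ¬ (b v ∧ r v) → Seen L (fun v => b v ∧ r v) v (l ++ [u]) = _ :=
      seen_append_of_not (R := fun v => b v ∧ r v) l [u]
    by_cases hb : b v
    · have e2 : ind b v = 1 := ind_eq_one.2 hb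
      by_cases hr : r v
      · have e3 : ind r v = 1 := ind_eq_one.2 hr
        have e : (Prog.seq (.load 12 2 1) (.branch (.eq 12 6)
            (.seq (.load 12 3 1) (.branch (.eq 12 6) (.store 5 4 6) (.store 4 4 6))) .skip)).den s =
            ((s.setReg 12 1).setReg 12 1).setArr 5 u 1 := by
          simp [Prog.den, Test.holds, h1, h4, hs.one, h2, h3, e2, e3, State.setReg_reg_of_ne]
        rw [e]
        refine ⟨Tables.setArr_five ?_ (update_ind_seen ⟨hb, hr⟩), hf⟩
        rw [hx (by tauto)]
        exact ht.of_arr_eq rfl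
      · have e3 : ind r v = 0 := ind_eq_zero.2 hr
        have e : (Prog.seq (.load 12 2 1) (.branch (.eq 12 6)
            (.seq (.load 12 3 1) (.branch (.eq 12 6) (.store 5 4 6) (.store 4 4 6))) .skip)).den s =
            ((s.setReg 12 1).setReg 12 0).setArr 4 u 1 := by
          simp [Prog.den, Test.holds, h1, h4, hs.one, h2, h3, e2, e3, State.setReg_reg_of_ne]
        rw [e]
        refine ⟨Tables.setArr_four ?_ (update_ind_seen ⟨hb, hr⟩), hf⟩
        rw [hy (by tauto)]
        exact ht.of_arr_eq rfl
    · have e2 : ind b v = 0 := ind_eq_zero.2 hb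
      have e : (Prog.seq (.load 12 2 1) (.branch (.eq 12 6)
          (.seq (.load 12 3 1) (.branch (.eq 12 6) (.store 5 4 6) (.store 4 4 6))) .skip)).den s =
          s.setReg 12 0 := by
        simp [Prog.den, Test.holds, h1, hs.one, h2, e2, State.setReg_reg_of_ne]
      rw [e]
      refine ⟨?_, hf⟩
      rw [hx (by tauto), hy (by tauto)]
      exact ht.of_arr_eq rfl
  · rintro s v - - - ⟨ht, h⟩
    exact ⟨by rwa [← seen_done, ← seen_done], h⟩

theorem runsIn_classify (hL : Stores n L off adj) {s : State} (hs : Ctx n k off adj s)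
    (ht : Tables b r ax ay (fun _ => False) (fun _ => False) fo s.data) (hf : s.data.fail = 0) :
    RunsIn classify s (30 * (n + off n) + 2) fun s' => Ctx n k off adj s' ∧
      Tables b r ax ay (fun v => v < n ∧ ¬ b v ∧ ¬ ax v ∧ ¬ ay v)
        (fun v => v < n ∧ ¬ b v ∧ ¬ (ax v ↔ ay v)) fo s'.data ∧ s'.data.fail = 0 := by
  let J : ℕ → Data → Prop := fun v d =>
    Tables b r ax ay (fun i => i < v ∧ ¬ b i ∧ ¬ ax i ∧ ¬ ay i)
        (fun i => i < v ∧ ¬ b i ∧ ¬ (ax i ↔ ay i)) fo d ∧ d.fail = 0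
  have extend : ∀ {P : ℕ → Prop} {v : ℕ}, P v →
      (fun i => i < v + 1 ∧ P i) = fun i => (i < v ∧ P i) ∨ i = v := by
    intro P v hP; funext i; grind
  have extend_not : ∀ {P : ℕ → Prop} {v : ℕ}, ¬ P v →
      (fun i => i < v + 1 ∧ P i) = fun i => i < v ∧ P i := by
    intro P v hP; funext i; grind
  refine runsIn_scan hL rfl rfl rfl J (fun v _ => J v) (by decide) ?_ ?_ ?_ hs
    ⟨by simpa using ht, hf⟩
  · intro s v _ _ _ h; exact h
  · intro s v l u _ _ _ _ _ h; exact h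
  · rintro s v - hs h1 ⟨ht, hf⟩
    have h2 : s.arr 2 = ind b := ht.arr_two
    have h4 : s.arr 4 = ind ax := ht.arr_four
    have h5 : s.arr 5 = ind ay := ht.arr_five
    simp only [J]
    by_cases hb : b v
    · have e2 : ind b v = 1 := ind_eq_one.2 hb
      have e : (Prog.seq (.load 12 2 1) (.branch (.eq 12 6) .skip
          (.seq (.load 12 4 1) (.seq (.load 13 5 1) (.branch (.eq 12 13)
          (.branch (.eq 12 5) (.store 6 1 6) .skip) (.store 7 1 6)))))).den s =
          s.setReg 12 1 := by
        simp [Prog.den, Test.holds, h1, hs.one, h2, e2, State.setReg_reg_of_ne]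
      rw [e, extend_not (by tauto), extend_not (by tauto)]
      exact ⟨ht.of_arr_eq rfl, hf⟩
    · have e2 : ind b v = 0 := ind_eq_zero.2 hb
      have e : (Prog.seq (.load 12 2 1) (.branch (.eq 12 6) .skip
          (.seq (.load 12 4 1) (.seq (.load 13 5 1) (.branch (.eq 12 13)
          (.branch (.eq 12 5) (.store 6 1 6) .skip) (.store 7 1 6)))))).den s =
          (Prog.branch (.eq 12 13) (.branch (.eq 12 5) (.store 6 1 6) .skip) (.store 7 1 6)).den
            (((s.setReg 12 0).setReg 12 (ind ax v)).setReg 13 (ind ay v)) := by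
        simp [Prog.den, Test.holds, h1, hs.one, h2, h4, h5, e2, State.setReg_reg_of_ne]
      rw [e]
      clear e
      by_cases hax : ax v <;> by_cases hay : ay v
      · have e4 : ind ax v = 1 := ind_eq_one.2 hax
        have e5 : ind ay v = 1 := ind_eq_one.2 hay
        rw [extend_not (by tauto), extend_not (by tauto)]
        have e : (Prog.branch (.eq 12 13) (.branch (.eq 12 5) (.store 6 1 6) .skip)
            (.store 7 1 6)).den (((s.setReg 12 0).setReg 12 (ind ax v)).setReg 13 (ind ay v)) =
            ((s.setReg 12 0).setReg 12 (ind ax v)).setReg 13 (ind ay v) := by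
          simp [Prog.den, Test.holds, hs.zero, e4, e5, State.setReg_reg_of_ne]
        rw [e]
        exact ⟨ht.of_arr_eq rfl, hf⟩
      · have e4 : ind ax v = 1 := ind_eq_one.2 hax
        have e5 : ind ay v = 0 := ind_eq_zero.2 hay
        rw [extend_not (by tauto), extend (by tauto)]
        have e : (Prog.branch (.eq 12 13) (.branch (.eq 12 5) (.store 6 1 6) .skip)
            (.store 7 1 6)).den (((s.setReg 12 0).setReg 12 (ind ax v)).setReg 13 (ind ay v)) =
            (((s.setReg 12 0).setReg 12 (ind ax v)).setReg 13 (ind ay v)).setArr 7 v 1 := by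
          simp [Prog.den, Test.holds, hs.one, h1, e4, e5, State.setReg_reg_of_ne]
        rw [e]
        exact ⟨Tables.setArr_seven (ht.of_arr_eq rfl) (update_ind_one _ _), hf⟩
      · have e4 : ind ax v = 0 := ind_eq_zero.2 hax
        have e5 : ind ay v = 1 := ind_eq_one.2 hay
        rw [extend_not (by tauto), extend (by tauto)]
        have e : (Prog.branch (.eq 12 13) (.branch (.eq 12 5) (.store 6 1 6) .skip)
            (.store 7 1 6)).den (((s.setReg 12 0).setReg 12 (ind ax v)).setReg 13 (ind ay v)) =
            (((s.setReg 12 0).setReg 12 (ind ax v)).setReg 13 (ind ay v)).setArr 7 v 1 := by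
          simp [Prog.den, Test.holds, hs.one, h1, e4, e5, State.setReg_reg_of_ne]
        rw [e]
        exact ⟨Tables.setArr_seven (ht.of_arr_eq rfl) (update_ind_one _ _), hf⟩
      · have e4 : ind ax v = 0 := ind_eq_zero.2 hax
        have e5 : ind ay v = 0 := ind_eq_zero.2 hay
        rw [extend (by tauto), extend_not (by tauto)]
        have e : (Prog.branch (.eq 12 13) (.branch (.eq 12 5) (.store 6 1 6) .skip)
            (.store 7 1 6)).den (((s.setReg 12 0).setReg 12 (ind ax v)).setReg 13 (ind ay v)) =
            (((s.setReg 12 0).setReg 12 (ind ax v)).setReg 13 (ind ay v)).setArr 6 v 1 := by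
          simp [Prog.den, Test.holds, hs.one, hs.zero, h1, e4, e5, State.setReg_reg_of_ne]
        rw [e]
        exact ⟨Tables.setArr_six (ht.of_arr_eq rfl) (update_ind_one _ _), hf⟩

open Classical in
/-- The entries of `l` that satisfy `av`. -/
noncomputable def availIn (av : ℕ → Prop) (l : List ℕ) : List ℕ := l.filter fun u => av u

theorem availIn_append_of {l : List ℕ} {u : ℕ} (h : av u) :
    availIn av (l ++ [u]) = availIn av l ++ [u] := by
  simp [availIn, h]

theorem availIn_append_of_not {l : List ℕ} {u : ℕ} (h : ¬ av u) :
    availIn av (l ++ [u]) = availIn av l := by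
  simp [availIn, h]

theorem mem_availIn {l : List ℕ} {u : ℕ} : u ∈ availIn av l ↔ u ∈ l ∧ av u := by
  simp [availIn]

/-- The scan does not change `av`, so all clauses of a round are judged against the same available
vertices. Forced vertices and the failure flag accumulate over the rounds. -/
theorem runsIn_collect (hL : Stores n L off adj) {s : State} (hs : Ctx n k off adj s) {fl : Prop}
    (ht : Tables b r ax ay av im fo s.data) (hf : s.data.fail = truthValue fl) :
    RunsIn collect s (30 * (n + off n) + 2) fun s' => Ctx n k off adj s' ∧
      Tables b r ax ay av im (fun u => fo u ∨ ∃ m < n, im m ∧ availIn av (L m) = [u]) s'.data ∧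
      s'.data.fail = truthValue (fl ∨ ∃ m < n, im m ∧ availIn av (L m) = []) := by
  let J : ℕ → Data → Prop := fun v d =>
    Tables b r ax ay av im (fun u => fo u ∨ ∃ m < v, im m ∧ availIn av (L m) = [u]) d ∧
      d.fail = truthValue (fl ∨ ∃ m < v, im m ∧ availIn av (L m) = [])
  -- The last available entry matters only when it is the only one.
  let I : ℕ → List ℕ → Data → Prop := fun v l d => J v d ∧ d.count = (availIn av l).length ∧
    ∀ u, availIn av l = [u] → d.last = u
  have lt_succ : ∀ (P : ℕ → Prop) (v : ℕ), (∃ m < v + 1, P m) ↔ (∃ m < v, P m) ∨ P v := by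
    intro P v
    constructor
    · rintro ⟨m, hm, h⟩
      rcases Nat.le_iff_lt_or_eq.1 (Nat.lt_succ_iff.1 hm) with hm | rfl
      exacts [Or.inl ⟨m, hm, h⟩, Or.inr h]
    · rintro (⟨m, hm, h⟩ | h)
      exacts [⟨m, by omega, h⟩, ⟨v, by omega, h⟩]
  refine runsIn_scan hL rfl rfl rfl J I (by decide) ?_ ?_ ?_ hs ⟨by simpa using ht, by simpa using hf⟩
  · rintro s v - - - ⟨ht, hf⟩
    exact ⟨⟨ht.of_arr_eq rfl, hf⟩, by simp [availIn, Prog.den, State.data], by simp [availIn]⟩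
  · rintro s v l u - hs - h1 h4 ⟨⟨ht, hf⟩, hc, hl⟩
    have h6 : s.arr 6 = ind av := ht.arr_six
    by_cases hu : av u
    · have e6 : ind av u = 1 := ind_eq_one.2 hu
      have e : (Prog.seq (.load 12 6 4)
          (.branch (.eq 12 6) (.seq (.succ 9) (.copy 10 4)) .skip)).den s =
          ((s.setReg 12 1).setReg 9 (s.reg 9 + 1)).setReg 10 u := by
        simp [Prog.den, Test.holds, h4, hs.one, h6, e6, State.setReg_reg_of_ne]
      rw [e]
      refine ⟨⟨ht.of_arr_eq rfl, hf⟩, ?_, ?_⟩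
      · rw [availIn_append_of hu, List.length_append, ← hc]
        rfl
      · rw [availIn_append_of hu]
        intro w hw
        have : u = w := by
          have := congrArg List.getLast? hw
          simpa using this
        exact this
    · have e6 : ind av u = 0 := ind_eq_zero.2 hu
      have e : (Prog.seq (.load 12 6 4)
          (.branch (.eq 12 6) (.seq (.succ 9) (.copy 10 4)) .skip)).den s = s.setReg 12 0 := by
        simp [Prog.den, Test.holds, h4, hs.one, h6, e6, State.setReg_reg_of_ne]
      rw [e]
      simp only [I, availIn_append_of_not hu]
      exact ⟨⟨ht.of_arr_eq rfl, hf⟩, hc, hl⟩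
  · rintro s v - hs h1 ⟨⟨ht, hf⟩, hc, hl⟩
    have h7 : s.arr 7 = ind im := ht.arr_seven
    have h9 : s.reg 9 = (availIn av (L v)).length := hc
    simp only [J, lt_succ]
    by_cases hm : im v
    · have e7 : ind im v = 1 := ind_eq_one.2 hm
      rcases hlist : availIn av (L v) with _ | ⟨w, _ | ⟨w', l⟩⟩
      · have e : (Prog.seq (.load 12 7 1) (.branch (.eq 12 6) (.branch (.eq 9 5) (.const 11 1)
            (.branch (.eq 9 6) (.store 8 10 6) .skip)) .skip)).den s =
            (s.setReg 12 1).setReg 11 1 := by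
          simp [Prog.den, Test.holds, h1, hs.one, hs.zero, h7, e7, h9, hlist,
            State.setReg_reg_of_ne]
        rw [e]
        refine ⟨by simpa using ht.of_arr_eq (d' := ((s.setReg 12 1).setReg 11 1).data) rfl, ?_⟩
        rw [truthValue_of (Or.inr (Or.inr ⟨hm, rfl⟩))]
        rfl
      · have hw : s.reg 10 = w := hl w hlist
        have e : (Prog.seq (.load 12 7 1) (.branch (.eq 12 6) (.branch (.eq 9 5) (.const 11 1)
            (.branch (.eq 9 6) (.store 8 10 6) .skip)) .skip)).den s =
            (s.setReg 12 1).setArr 8 w 1 := by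
          simp [Prog.den, Test.holds, h1, hs.one, hs.zero, h7, e7, h9, hlist, hw,
            State.setReg_reg_of_ne]
        rw [e]
        refine ⟨Tables.setArr_eight (ht.of_arr_eq rfl) ?_, .trans (b := s.data.fail) rfl (by simpa using hf)⟩
        rw [update_ind_one]
        congr 1
        funext i
        simp [hm, or_assoc, eq_comm]
      · have e : (Prog.seq (.load 12 7 1) (.branch (.eq 12 6) (.branch (.eq 9 5) (.const 11 1)
            (.branch (.eq 9 6) (.store 8 10 6) .skip)) .skip)).den s = s.setReg 12 1 := by
          simp [Prog.den, Test.holds, h1, hs.one, hs.zero, h7, e7, h9, hlist,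
            State.setReg_reg_of_ne]
        rw [e]
        exact ⟨by simpa using ht.of_arr_eq (d' := (s.setReg 12 1).data) rfl,
          .trans (b := s.data.fail) rfl (by simpa using hf)⟩
    · have e7 : ind im v = 0 := ind_eq_zero.2 hm
      have e : (Prog.seq (.load 12 7 1) (.branch (.eq 12 6) (.branch (.eq 9 5) (.const 11 1)
          (.branch (.eq 9 6) (.store 8 10 6) .skip)) .skip)).den s = s.setReg 12 0 := by
        simp [Prog.den, Test.holds, h1, hs.one, h7, e7, State.setReg_reg_of_ne]
      rw [e]
      exact ⟨by simpa [hm] using ht.of_arr_eq (d' := (s.setReg 12 0).data) rfl,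
        .trans (b := s.data.fail) rfl (by simpa [hm] using hf)⟩

theorem runsIn_discard (hL : Stores n L off adj) {s : State} (hs : Ctx n k off adj s) {x : ℕ}
    (ht : Tables b r ax ay av im fo s.data) (hf : s.data.fail = x) :
    RunsIn discard s (30 * (n + off n) + 2) fun s' => Ctx n k off adj s' ∧
      Tables b r ax ay (fun u => av u ∧ ¬ ∃ w < n, fo w ∧ u ∈ L w) im fo s'.data ∧
      s'.data.fail = x := by
  let I : ℕ → List ℕ → Data → Prop := fun v l d =>
    Tables b r ax ay (fun u => av u ∧ ¬ Seen L fo v l u) im fo d ∧ d.fail = x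
  refine (runsIn_scan hL rfl rfl rfl (fun v => I v []) I (by decide) ?_ ?_ ?_ hs
    ⟨by simpa [seen_zero] using ht, hf⟩).mono le_rfl
    fun s' h => ⟨h.1, by simpa only [seen_nil] using h.2.1, h.2.2⟩
  · intro s v _ _ _ h; exact h
  · rintro s v l u - hs - h1 h4 ⟨ht, hf⟩
    have h8 : s.arr 8 = ind fo := ht.arr_eight
    by_cases hv : fo v
    · have e8 : ind fo v = 1 := ind_eq_one.2 hv
      have e : (Prog.seq (.load 12 8 1) (.branch (.eq 12 6) (.store 6 4 5) .skip)).den s =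
          (s.setReg 12 1).setArr 6 u 0 := by
        simp [Prog.den, Test.holds, h1, h4, hs.one, hs.zero, h8, e8, State.setReg_reg_of_ne]
      rw [e]
      refine ⟨Tables.setArr_six (ht.of_arr_eq rfl) ?_, hf⟩
      rw [update_ind_zero, seen_append_of l hv]
      simp only [not_or, and_assoc, ne_eq]
    · have e8 : ind fo v = 0 := ind_eq_zero.2 hv
      have e : (Prog.seq (.load 12 8 1) (.branch (.eq 12 6) (.store 6 4 5) .skip)).den s =
          s.setReg 12 0 := by
        simp [Prog.den, Test.holds, h1, hs.one, h8, e8, State.setReg_reg_of_ne]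
      rw [e]
      simp only [I, seen_append_of_not l [u] hv]
      exact ⟨ht.of_arr_eq rfl, hf⟩
  · rintro s v - - - ⟨ht, h⟩
    exact ⟨by rwa [← seen_done], h⟩

end RAM

namespace RAM

/-! ### Unit propagation -/

/-- The state of the propagation: available vertices, selected vertices, and whether it failed. -/
structure Selection where
  avail : ℕ → Prop
  forced : ℕ → Prop
  failed : Prop

/-- Some vertex satisfying `im` has no available neighbour. -/
def HasUndominated (n : ℕ) (L : ℕ → List ℕ) (im av : ℕ → Prop) : Prop :=
  ∃ m < n, im m ∧ availIn av (L m) = []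

/-- One round of unit propagation. -/
def Selection.next (n : ℕ) (L : ℕ → List ℕ) (im : ℕ → Prop) (σ : Selection) : Selection where
  avail u := σ.avail u ∧
    ¬ ∃ w < n, (σ.forced w ∨ ∃ m < n, im m ∧ availIn σ.avail (L m) = [w]) ∧ u ∈ L w
  forced u := σ.forced u ∨ ∃ m < n, im m ∧ availIn σ.avail (L m) = [u]
  failed := σ.failed ∨ HasUndominated n L im σ.avail

/-- The state of the propagation after `k` rounds, started with the available vertices `av`. -/
def selection (n : ℕ) (L : ℕ → List ℕ) (im av : ℕ → Prop) : ℕ → Selection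
  | 0 => ⟨av, fun _ => False, False⟩
  | k + 1 => (selection n L im av k).next n L im

variable {n : ℕ} {off adj : ℕ → ℕ} {L : ℕ → List ℕ} {b r ax ay av im : ℕ → Prop}

theorem runsIn_round (hL : Stores n L off adj) {s : State} {k : ℕ} (hs : Ctx n k off adj s)
    {σ : Selection} (ht : Tables b r ax ay σ.avail im σ.forced s.data)
    (hf : s.data.fail = truthValue σ.failed) :
    RunsIn (.seq (.seq collect discard) (.succ 7)) s (60 * (n + off n) + 5) fun s' =>
      Ctx n (k + 1) off adj s' ∧
      Tables b r ax ay (σ.next n L im).avail im (σ.next n L im).forced s'.data ∧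
      s'.data.fail = truthValue (σ.next n L im).failed := by
  refine (((runsIn_collect hL hs ht hf).seq fun s₁ h₁ =>
    runsIn_discard hL h₁.1 h₁.2.1 h₁.2.2).seq (T' := 1) fun s₂ h₂ =>
      ⟨1, _, .succ s₂ 7, le_rfl, ?_⟩).mono (by omega) fun _ h => h
  obtain ⟨hs₂, ht₂, hf₂⟩ := h₂
  refine ⟨⟨?_, ?_, ?_, ?_, hs₂.off, hs₂.adj⟩, ht₂.of_arr_eq rfl, hf₂⟩
  · rw [State.setReg_reg_of_ne _ (by decide), hs₂.size]
  · rw [State.setReg_reg_of_ne _ (by decide), hs₂.zero]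
  · rw [State.setReg_reg_of_ne _ (by decide), hs₂.one]
  · rw [State.setReg_reg_self, hs₂.round]

theorem runsIn_propagate (hL : Stores n L off adj) {s : State} {k : ℕ} (hs : Ctx n k off adj s)
    (ht : Tables b r ax ay av im (fun _ => False) s.data) (hf : s.data.fail = 0) :
    RunsIn propagate s ((60 * (n + off n) + 6) * n + 2) fun s' => Ctx n n off adj s' ∧
      Tables b r ax ay (selection n L im av n).avail im (selection n L im av n).forced s'.data ∧
      s'.data.fail = truthValue (selection n L im av n).failed := by
  have key : ∀ d k s, k + d = n → Ctx n k off adj s →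
      Tables b r ax ay (selection n L im av k).avail im (selection n L im av k).forced s.data →
      (s.data.fail = truthValue (selection n L im av k).failed) →
      RunsIn (.loop (.lt 7 0) (.seq (.seq collect discard) (.succ 7))) s
        ((60 * (n + off n) + 6) * d + 1) fun s' => Ctx n n off adj s' ∧
        Tables b r ax ay (selection n L im av n).avail im (selection n L im av n).forced s'.data ∧
        s'.data.fail = truthValue (selection n L im av n).failed := by
    intro d
    induction d with
    | zero =>
      intro k s hk hs ht hf
      obtain rfl : k = n := by omega
      exact ⟨1, s, .loop_false (by simp [Test.holds, hs.round, hs.size]), by omega, hs, ht, hf⟩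
    | succ d ih =>
      intro k s hk hs ht hf
      obtain ⟨t, s', he, hle, hs', ht', hf'⟩ := runsIn_round hL hs ht hf
      obtain ⟨t', s'', he', hle', h⟩ := ih (k + 1) s' (by omega) hs' ht' hf'
      refine ⟨_, s'', .loop_true ?_ he he', ?_, h⟩
      · simp only [Test.holds, hs.round, hs.size]
        omega
      · rw [Nat.mul_succ]
        omega
  have hs₀ : Ctx n 0 off adj (s.setReg 7 0) := by
    refine ⟨?_, ?_, ?_, State.setReg_reg_self _ _ _, hs.off, hs.adj⟩
    · rw [State.setReg_reg_of_ne _ (by decide), hs.size]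
    · rw [State.setReg_reg_of_ne _ (by decide), hs.zero]
    · rw [State.setReg_reg_of_ne _ (by decide), hs.one]
  obtain ⟨t, s', he, hle, h⟩ := key n 0 (s.setReg 7 0) (by omega) hs₀ (ht.of_arr_eq rfl)
    (.trans (b := s.data.fail) rfl (hf.trans (truthValue_of_not id).symm))
  exact ⟨_, s', .seq (.const _ _ _) he, by omega, h⟩

/-- The neighbours of the root. -/
def rootNbr (L : ℕ → List ℕ) (n root : ℕ) : ℕ → Prop := Seen L (· = root) n []

/-- The vertices with a neighbour in the part of `b` outside `r`. -/
def nbrOut (L : ℕ → List ℕ) (n : ℕ) (b r : ℕ → Prop) : ℕ → Prop :=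
  Seen L (fun v => b v ∧ ¬ r v) n []

/-- The vertices with a neighbour in the part of `b` inside `r`. -/
def nbrIn (L : ℕ → List ℕ) (n : ℕ) (b r : ℕ → Prop) : ℕ → Prop :=
  Seen L (fun v => b v ∧ r v) n []

/-- The vertices outside `b` that are neither in `ax` nor in `ay`. -/
def farPred (n : ℕ) (b ax ay : ℕ → Prop) (v : ℕ) : Prop := v < n ∧ ¬ b v ∧ ¬ ax v ∧ ¬ ay v

/-- The vertices outside `b` that are in exactly one of `ax` and `ay`. -/
def oneSidedPred (n : ℕ) (b ax ay : ℕ → Prop) (v : ℕ) : Prop := v < n ∧ ¬ b v ∧ ¬ (ax v ↔ ay v)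

/-- The last state of the propagation for a given root. -/
def lastSelection (n : ℕ) (L : ℕ → List ℕ) (b : ℕ → Prop) (root : ℕ) : Selection :=
  selection n L
    (oneSidedPred n b (nbrOut L n b (rootNbr L n root)) (nbrIn L n b (rootNbr L n root)))
    (farPred n b (nbrOut L n b (rootNbr L n root)) (nbrIn L n b (rootNbr L n root))) n

/-- The propagation for a given root finds a vertex that cannot be dominated. -/
def Rejects (n : ℕ) (L : ℕ → List ℕ) (b : ℕ → Prop) (root : ℕ) : Prop :=
  (lastSelection n L b root).failed ∨ HasUndominated n L
    (oneSidedPred n b (nbrOut L n b (rootNbr L n root)) (nbrIn L n b (rootNbr L n root)))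
    (lastSelection n L b root).avail

/-- Besides the propagation there are five single scans, of `30 * (n + off n) + 2` steps each, and
three further steps. -/
theorem runsIn_decideGenerating (hL : Stores n L off adj) {s : State}
    (hs : Ctx n 0 off adj (s.setReg 6 1))
    (ht : Tables b (fun _ => False) (fun _ => False) (fun _ => False) (fun _ => False)
      (fun _ => False) (fun _ => False) s.data) (hf : s.data.fail = 0) (hb : ∃ v < n, b v) :
    RunsIn decideGenerating s ((60 * (n + off n) + 6) * n + 150 * (n + off n) + 15) fun s' =>
      ∃ root, b root ∧ s'.reg 0 = truthValue (¬ Rejects n L b root) := by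
  obtain ⟨t₁, s₁, e₁, l₁, hs₁, ht₁, hf₁, hr₁⟩ :=
    runsIn_findRoot hL hs (ht.of_arr_eq rfl) (.trans (b := s.data.fail) rfl hf) hb
  obtain ⟨t₂, s₂, e₂, l₂, hs₂, ht₂, hf₂⟩ := runsIn_markRoot hL hs₁ ht₁ hf₁ rfl
  obtain ⟨t₃, s₃, e₃, l₃, hs₃, ht₃, hf₃⟩ := runsIn_markSides hL hs₂ ht₂ hf₂
  obtain ⟨t₄, s₄, e₄, l₄, hs₄, ht₄, hf₄⟩ := runsIn_classify hL hs₃ ht₃ hf₃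
  obtain ⟨t₅, s₅, e₅, l₅, hs₅, ht₅, hf₅⟩ := runsIn_propagate hL hs₄ ht₄ hf₄
  obtain ⟨t₆, s₆, e₆, l₆, hs₆, ht₆, hf₆⟩ := runsIn_collect hL hs₅ ht₅ hf₅
  have h11 : s₆.reg 11 = truthValue (Rejects n L b s₁.data.root) := hf₆
  by_cases hrej : Rejects n L b s₁.data.root
  · rw [truthValue_of hrej] at h11
    refine ⟨_, _, .seq (.const _ _ _) (.seq e₁ (.seq e₂ (.seq e₃ (.seq e₄ (.seq e₅ (.seq e₆
      (.branch_false (by simp [Test.holds, h11, hs₆.zero]) (.const _ _ _)))))))), by omega,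
      s₁.data.root, hr₁, ?_⟩
    rw [State.setReg_reg_self, truthValue_of_not (not_not.2 hrej)]
  · rw [truthValue_of_not hrej] at h11
    refine ⟨_, _, .seq (.const _ _ _) (.seq e₁ (.seq e₂ (.seq e₃ (.seq e₄ (.seq e₅ (.seq e₆
      (.branch_true (by simp [Test.holds, h11, hs₆.zero]) (.const _ _ _)))))))), by omega,
      s₁.data.root, hr₁, ?_⟩
    rw [State.setReg_reg_self, truthValue_of hrej]

end RAM

/-! ### Correctness of the propagation -/

section Correctness

open RAM

variable {n : ℕ} {G : SimpleGraph (Fin n)} {L : ℕ → List ℕ} {X Y : Set (Fin n)} {im av : ℕ → Prop}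

/-- `L v` lists the neighbours of `v` without repetition. -/
structure ListsNeighbors (G : SimpleGraph (Fin n)) (L : ℕ → List ℕ) : Prop where
  nodup : ∀ v, (L v).Nodup
  mem_iff : ∀ (v : Fin n) (u : ℕ), u ∈ L v ↔ ∃ h : u < n, G.Adj v ⟨u, h⟩

theorem ListsNeighbors.mem_iff_adj (hG : ListsNeighbors G L) {v u : Fin n} :
    (u : ℕ) ∈ L v ↔ G.Adj v u := by
  rw [hG.mem_iff]; simp

theorem List.Nodup.eq_singleton {α : Type*} {l : List α} (hl : l.Nodup) {a : α} (ha : a ∈ l)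
    (h : ∀ b ∈ l, b = a) : l = [a] := by
  rcases l with _ | ⟨b, _ | ⟨c, l⟩⟩
  · simp at ha
  · rw [h b (by simp)]
  · have hb := h b (by simp)
    have hc := h c (by simp)
    simp [hb, hc] at hl

/-- Every dominating set survives the propagation. -/
theorem selection_invariant (hG : ListsNeighbors G L)
    (him : ∀ i : Fin n, im i ↔ i ∈ oneSidedSet G X Y) (hav : ∀ i : Fin n, av i ↔ i ∈ farSet G X Y)
    {S : Set (Fin n)} (hS : IsDominatingFar G X Y S) (k : ℕ) :
    (∀ i ∈ S, (selection n L im av k).avail i) ∧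
      (∀ u, (selection n L im av k).forced u → ∃ i ∈ S, (i : ℕ) = u) ∧
      ¬ (selection n L im av k).failed := by
  induction k with
  | zero => exact ⟨fun i hi => (hav i).2 (hS.1 hi), fun _ h => h.elim, id⟩
  | succ k ih =>
    obtain ⟨iha, ihf, ihn⟩ := ih
    set σ := selection n L im av k
    have hmem : ∀ m < n, im m → ∃ i ∈ S, (i : ℕ) ∈ availIn σ.avail (L m) := by
      intro m hm himm
      obtain ⟨w, hw, hmw⟩ := hS.2.2 ⟨m, hm⟩ ((him ⟨m, hm⟩).1 himm)
      exact ⟨w, hw, mem_availIn.2 ⟨(hG.mem_iff_adj (v := ⟨m, hm⟩)).2 hmw, iha w hw⟩⟩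
    -- `S` contains an available neighbour of `m`; if only one is available, it lies in `S`.
    have hforced : ∀ u, (σ.forced u ∨ ∃ m < n, im m ∧ availIn σ.avail (L m) = [u]) →
        ∃ i ∈ S, (i : ℕ) = u := by
      rintro u (hu | ⟨m, hm, himm, hl⟩)
      · exact ihf u hu
      · obtain ⟨i, hi, hil⟩ := hmem m hm himm
        rw [hl, List.mem_singleton] at hil
        exact ⟨i, hi, hil⟩
    refine ⟨fun i hi => ⟨iha i hi, ?_⟩, hforced, ?_⟩
    · rintro ⟨w, -, hw, hiw⟩
      obtain ⟨j, hj, rfl⟩ := hforced w hw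
      exact hS.2.1.not_adj hj hi (hG.mem_iff_adj.1 hiw)
    · rintro (h | ⟨m, hm, himm, hl⟩)
      · exact ihn h
      · obtain ⟨i, hi, hil⟩ := hmem m hm himm
        exact List.not_mem_nil (hl ▸ hil : (i : ℕ) ∈ [])

/-- Round `k + 1` records an undominated vertex of stage `k`, and the flag is never reset. -/
theorem not_hasUndominated_of_not_failed {k l : ℕ} (hkl : k < l)
    (h : ¬ (selection n L im av l).failed) :
    ¬ HasUndominated n L im (selection n L im av k).avail := by
  induction l, hkl using Nat.le_induction with
  | base => exact fun h' => h (Or.inr h')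
  | succ l _ ih => exact ih fun h' => h (Or.inl h')

/-- At the latest after `n` rounds, the propagation is stable. -/
theorem exists_selection_stable (n : ℕ) (L : ℕ → List ℕ) (im : ℕ → Prop) (av : ℕ → Prop)
    (hav : ∀ u, av u → u < n) :
    ∃ k ≤ n, ∀ u, (selection n L im av k).avail u → (selection n L im av (k + 1)).avail u := by
  classical
  by_contra! hne
  have hlt : ∀ k u, (selection n L im av k).avail u → u < n := by
    intro k
    induction k with
    | zero => exact hav
    | succ k ih => exact fun u hu => ih u hu.1
  -- An unstable round loses at least one of at most `n` available vertices, so `n + 1` unstable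
  -- rounds are impossible.
  have key : ∀ k ≤ n + 1,
      ((Finset.range n).filter (selection n L im av k).avail).card + k ≤ n := by
    intro k
    induction k with
    | zero => exact fun _ => by simpa using Finset.card_filter_le (Finset.range n) _
    | succ k ih =>
      intro hk
      obtain ⟨u, hu, hu'⟩ := hne k (by omega)
      have : ((Finset.range n).filter (selection n L im av (k + 1)).avail).card <
          ((Finset.range n).filter (selection n L im av k).avail).card := by
        refine Finset.card_lt_card (Finset.ssubset_iff_of_subset ?_ |>.2 ⟨u, ?_, ?_⟩)
        · exact Finset.monotone_filter_right _ fun v _ hv => hv.1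
        · simpa using ⟨hlt k u hu, hu⟩
        · simp [hu']
      have := ih (by omega)
      omega
  have := key (n + 1) le_rfl
  omega

/-- At a stable stage `k ≤ n`, a single available neighbour would be forced in the next round and
its neighbours discarded; by stability none of these was available. This is the isolation required
by `exists_isDominatingFar`. The index `n + 1` appears because stage `n` is checked one round later.
-/
theorem exists_isDominatingFar_iff (hG : ListsNeighbors G L)
    (him : ∀ i : Fin n, im i ↔ i ∈ oneSidedSet G X Y) (hav : ∀ i : Fin n, av i ↔ i ∈ farSet G X Y)
    (hlt : ∀ u, av u → u < n) {B : Set (Fin n)} (h : IsCompleteBipartition G B X Y)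
    (h4 : (SimpleGraph.cycleGraph 4).Free G) (h6 : (SimpleGraph.cycleGraph 6).Free G)
    (h7 : (SimpleGraph.cycleGraph 7).Free G) :
    (∃ S, IsDominatingFar G X Y S) ↔ ¬ (selection n L im av (n + 1)).failed := by
  constructor
  · rintro ⟨S, hS⟩
    exact (selection_invariant hG him hav hS (n + 1)).2.2
  · intro hnf
    obtain ⟨k, hk, hstable⟩ := exists_selection_stable n L im av hlt
    have hund := not_hasUndominated_of_not_failed (k := k) (by omega) hnf
    have hsub : ∀ k u, (selection n L im av k).avail u → av u := by
      intro k
      induction k with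
      | zero => exact fun u hu => hu
      | succ k ih => exact fun u hu => ih u hu.1
    refine exists_isDominatingFar (A := {i : Fin n | (selection n L im av k).avail i}) h h4 h6 h7
      (fun i hi => (hav i).1 (hsub k i hi)) ?_ ?_
    · intro m hm
      by_contra! hne
      refine hund ⟨m, m.2, (him m).2 hm, List.eq_nil_iff_forall_not_mem.2 fun u hu => ?_⟩
      obtain ⟨hu, hua⟩ := mem_availIn.1 hu
      obtain ⟨hun, hadj⟩ := (hG.mem_iff m u).1 hu
      exact hne ⟨u, hun⟩ hua hadj
    · intro m hm w hw hmw huniq u hu hwu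
      refine (hstable u hu).2 ⟨w, w.2, Or.inr ⟨m, m.2, (him m).2 hm, ?_⟩, hG.mem_iff_adj.2 hwu⟩
      refine List.Nodup.eq_singleton ((hG.nodup m).filter _)
        (mem_availIn.2 ⟨hG.mem_iff_adj.2 hmw, hw⟩) fun v hv => ?_
      obtain ⟨hv, hva⟩ := mem_availIn.1 hv
      obtain ⟨hvn, hadj⟩ := (hG.mem_iff m v).1 hv
      exact congrArg Fin.val (huniq ⟨v, hvn⟩ hva hadj)

/-- The program rejects exactly the subgraphs that are not generating. -/
theorem isGenerating_iff_not_rejects (hG : ListsNeighbors G L) {B : Set (Fin n)} {b : ℕ → Prop}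
    (hb : ∀ u, b u ↔ ∃ i ∈ B, (i : ℕ) = u) (hB : InducesCompleteBipartite G B)
    (h4 : (SimpleGraph.cycleGraph 4).Free G) (h6 : (SimpleGraph.cycleGraph 6).Free G)
    (h7 : (SimpleGraph.cycleGraph 7).Free G) {root : ℕ} (hroot : b root) :
    IsGenerating G B ↔ ¬ Rejects n L b root := by
  obtain ⟨i₀, hi₀, rfl⟩ := (hb root).1 hroot
  obtain ⟨X, Y, h, hX⟩ : ∃ X Y, IsCompleteBipartition G B X Y ∧ i₀ ∈ X := by
    obtain ⟨X, Y, h⟩ := hB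
    rw [← h.union_eq] at hi₀
    rcases hi₀ with hi | hi
    exacts [⟨X, Y, h, hi⟩, ⟨Y, X, h.symm, hi⟩]
  have hbB : ∀ i : Fin n, b i ↔ i ∈ X ∪ Y := by
    intro i
    rw [hb, h.union_eq]
    exact ⟨fun ⟨j, hj, hji⟩ => Fin.ext hji ▸ hj, fun hi => ⟨i, hi, rfl⟩⟩
  have hr : ∀ i : Fin n, rootNbr L n i₀ i ↔ G.Adj i₀ i := by
    intro i
    rw [rootNbr, seen_nil, ← hG.mem_iff_adj]
    exact ⟨fun ⟨w, _, hw, hi⟩ => hw ▸ hi, fun hi => ⟨i₀, i₀.2, rfl, hi⟩⟩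
  -- The program is not given the sides; it recovers them from adjacency to the root.
  have hout : ∀ i : Fin n, (b i ∧ ¬ rootNbr L n i₀ i) ↔ i ∈ X := by
    intro i
    rw [hbB, hr]
    constructor
    · rintro ⟨hi | hi, hna⟩
      exacts [hi, absurd (h.adj i₀ hX i hi) hna]
    · exact fun hi => ⟨Or.inl hi, h.indep_left.not_adj hX hi⟩
  have hin : ∀ i : Fin n, (b i ∧ rootNbr L n i₀ i) ↔ i ∈ Y := by
    intro i
    rw [hbB, hr]
    constructor
    · rintro ⟨hi | hi, hna⟩
      exacts [absurd hna (h.indep_left.not_adj hX hi), hi]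
    · exact fun hi => ⟨Or.inr hi, h.adj i₀ hX i hi⟩
  have hseen : ∀ {R : ℕ → Prop} {T : Set (Fin n)}, (∀ i : Fin n, R i ↔ i ∈ T) →
      ∀ i : Fin n, Seen L R n [] i ↔ HasNeighborIn G T i := by
    intro R T hRT i
    rw [seen_nil]
    constructor
    · rintro ⟨w, hw, hRw, hi⟩
      exact ⟨⟨w, hw⟩, (hRT ⟨w, hw⟩).1 hRw, (hG.mem_iff_adj (v := ⟨w, hw⟩)).1 hi⟩
    · rintro ⟨w, hw, hwi⟩
      exact ⟨w, w.2, (hRT w).2 hw, hG.mem_iff_adj.2 hwi⟩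
  have hax : ∀ i : Fin n, nbrOut L n b (rootNbr L n i₀) i ↔ HasNeighborIn G X i := hseen hout
  have hay : ∀ i : Fin n, nbrIn L n b (rootNbr L n i₀) i ↔ HasNeighborIn G Y i := hseen hin
  rw [isGenerating_iff h, exists_isDominatingFar_iff hG _ _ (fun _ hu => And.left hu) h h4 h6 h7]
  -- The final check after `n` rounds is by definition the failure flag of round `n + 1`.
  · rfl
  · intro i
    simp only [oneSidedPred, i.2, true_and, hbB, hax, hay]
    rfl
  · intro i
    simp only [i.2, true_and, hbB, hax, hay]
    rfl

end Correctness

/-! ### The input -/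

section Input

open RAM

variable {n : ℕ} {G : SimpleGraph (Fin n)}

/-- The adjacency lists as lists of numbers. -/
def natLists (nbr : Fin n → List (Fin n)) (v : ℕ) : List ℕ :=
  if h : v < n then (nbr ⟨v, h⟩).map Fin.val else []

theorem IsAdjLists.listsNeighbors {nbr : Fin n → List (Fin n)} (h : IsAdjLists G nbr) :
    ListsNeighbors G (natLists nbr) where
  nodup v := by
    rw [natLists]
    split_ifs with hv
    · exact (h ⟨v, hv⟩).1.map Fin.val_injective
    · exact List.nodup_nil
  mem_iff v u := by
    simp only [natLists, v.2, dite_true, List.mem_map, (h v).2, Fin.eta]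
    exact ⟨fun ⟨a, ha, hau⟩ => hau ▸ ⟨a.2, ha⟩, fun ⟨hu, ha⟩ => ⟨_, ha, rfl⟩⟩

theorem stores_inputState (nbr : Fin n → List (Fin n)) (B : Finset (Fin n)) :
    Stores n (natLists nbr) ((inputState nbr B).arr 0) ((inputState nbr B).arr 1) where
  off_zero := by simp [inputState]
  off_succ v hv := by
    simp [inputState, natLists, hv, hv.le, Nat.succ_le_of_lt hv, List.take_add_one]
  adj_eq v hv i hi := by
    have hi' : i < (nbr ⟨v, hv⟩).length := by simpa [natLists, hv] using hi
    have e : (List.ofFn nbr).flatten = ((List.ofFn nbr).take v).flatten ++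
        (nbr ⟨v, hv⟩ ++ ((List.ofFn nbr).drop (v + 1)).flatten) := by
      conv_lhs => rw [← List.take_append_drop v (List.ofFn nbr)]
      rw [List.flatten_append, List.drop_eq_getElem_cons (by simpa using hv)]
      simp
    simp only [inputState, hv.le, if_true, one_ne_zero, if_false, natLists, hv, dite_true]
    rw [e, List.getD_eq_getElem?_getD, List.map_append, List.getElem?_append_right (by rw [List.length_map]; exact Nat.le_add_right _ _),
      List.length_map, Nat.add_sub_cancel_left, List.map_append,
      List.getElem?_append_left (by simpa using hi')]
    simp [hi']

/-- The handshake lemma: the list lengths are the degrees. -/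
theorem length_flatten_ofFn {nbr : Fin n → List (Fin n)} (h : IsAdjLists G nbr) :
    (List.ofFn nbr).flatten.length = 2 * G.edgeSet.ncard := by
  classical
  rw [List.length_flatten, List.map_ofFn, List.sum_ofFn, Set.ncard_eq_toFinset_card',
    ← SimpleGraph.edgeFinset, ← G.sum_degrees_eq_twice_card_edges]
  refine Finset.sum_congr rfl fun v _ => ?_
  rw [← SimpleGraph.card_neighborFinset_eq_degree, Function.comp_apply,
    ← List.toFinset_card_of_nodup (h v).1]
  congr 1
  ext w
  simp [(h v).2]

theorem tables_inputState (nbr : Fin n → List (Fin n)) (B : Finset (Fin n)) :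
    Tables (fun u => u ∈ B.map Fin.valEmbedding) (fun _ => False) (fun _ => False)
      (fun _ => False) (fun _ => False) (fun _ => False) (fun _ => False)
      (inputState nbr B).data := by
  constructor <;> funext i <;> simp [State.data, inputState, ind]

end Input

/-- There is one program that decides, for a graph `G` without (not necessarily induced) cycles of
length 4, 6 and 7, given by adjacency lists, and a complete bipartite induced subgraph of `G`,
given by its vertex set `B`, whether that subgraph is generating (answer `1` or `0` in
register `0`), in `O(|V| (|V| + |E|))` steps. -/
theorem theorem2 :
    ∃ (p : RAM.Prog) (c : ℕ),
      ∀ (n : ℕ) (G : SimpleGraph (Fin n)) (nbr : Fin n → List (Fin n)) (B : Finset (Fin n)),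
        IsAdjLists G nbr →
        (SimpleGraph.cycleGraph 4).Free G →
        (SimpleGraph.cycleGraph 6).Free G →
        (SimpleGraph.cycleGraph 7).Free G →
        InducesCompleteBipartite G (B : Set (Fin n)) →
        ∃ (t : ℕ) (s : RAM.State),
          RAM.Exec p (inputState nbr B) t s ∧
          t ≤ c * (n * (n + G.edgeSet.ncard)) ∧
          (IsGenerating G (B : Set (Fin n)) → s.reg 0 = 1) ∧
          (¬ IsGenerating G (B : Set (Fin n)) → s.reg 0 = 0) := by
  refine ⟨RAM.decideGenerating, 441, fun n G nbr B hnbr h4 h6 h7 hB => ?_⟩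
  have hctx : RAM.Ctx n 0 ((inputState nbr B).arr 0) ((inputState nbr B).arr 1)
      ((inputState nbr B).setReg 6 1) := by
    constructor <;> simp [inputState, RAM.State.setReg]
  obtain ⟨i, hi⟩ : ∃ i, i ∈ B := by
    obtain ⟨X, Y, h⟩ := hB
    obtain ⟨x, hx⟩ := h.nonempty_left
    have : x ∈ X ∪ Y := Or.inl hx
    rw [h.union_eq] at this
    exact ⟨x, this⟩
  have hoff : (inputState nbr B).arr 0 n = 2 * G.edgeSet.ncard := by
    rw [← length_flatten_ofFn hnbr]
    simp [inputState, List.take_of_length_le]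
  obtain ⟨t, s, hexec, ht, root, hroot, hs⟩ := RAM.runsIn_decideGenerating
    (stores_inputState nbr B) hctx (tables_inputState nbr B) rfl
    ⟨i, i.2, Finset.mem_map.2 ⟨i, hi, rfl⟩⟩
  have hiff := isGenerating_iff_not_rejects hnbr.listsNeighbors
    (fun u => by simp) hB h4 h6 h7 hroot
  refine ⟨t, s, hexec, ht.trans ?_, fun h => ?_, fun h => ?_⟩
  · have hn : 1 ≤ n := by have := i.2; omega
    rw [hoff]
    generalize G.edgeSet.ncard = e
    obtain ⟨m, rfl⟩ : ∃ m, n = m + 1 := ⟨n - 1, by omega⟩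
    -- As `n ≥ 1`, lower-order terms are absorbed: the bound is at most `231 * n ^ 2 + 420 * n * e`,
    -- which 441 covers.
    nlinarith [Nat.zero_le (m * e), Nat.zero_le (m * m)]
  · rw [hs, RAM.truthValue_of (hiff.1 h)]
  · rw [hs, RAM.truthValue_of_not fun h' => h (hiff.2 h')]
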